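/- **Setting.** $\lambda$ is the security parameter; negligible means decaying faster than every inverse polynomial in $\lambda$. *Private coin scheme* $\mathsf{Pr\text{-}QC}$ (stateless, not assumed efficient): a probability distribution over secret keys $sk$ (for each $\lambda$); a pure state $|\phi\rangle=|\phi_{sk}\rangle$ of $q(\lambda)\ge 1$ qubits (the private coin), which is what every call of $\mathsf{mint}(sk)$ produces; and a two-outcome measurement $\mathsf{verify}(sk,\cdot)$ that accepts $|\phi_{sk}\rangle$ with probability $1$ (for almost every $sk$). $\mathsf{Count}(sk,\cdot)$ verifies the submitted states one by one and outputs the number of accepted ones. *Public coin scheme* $\mathsf{Pk\text{-}QC}$, for a constant $c>1$ and $\kappa=\lceil(\log_2\lambda)^c\rceil$: keys are those of $\mathsf{Pr\text{-}QC}$ and a public coin is $|\text{¢}\rangle=|\phi_{sk}\rangle^{\otimes\kappa}$. *Public count* of $m$ alleged coins: a wallet is initialised with a fresh coin $|\text{¢}\rangle$; for $i=1,\dots,m$ in turn, the $(i+1)\kappa$ registers consisting of the wallet (which already contains the alleged coins $1,\dots,i-1$) and of the alleged coin $i$ are measured with $\{\Pi_{\mathrm{Sym}},I-\Pi_{\mathrm{Sym}}\}$,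 where $\Pi_{\mathrm{Sym}}$ projects onto the symmetric subspace; the coin is accepted iff the outcome is $\Pi_{\mathrm{Sym}}$, and the post-measurement state becomes the wallet. *Private (bank) count*: for each alleged coin let $k$ be the outcome of $\mathsf{Pr\text{-}QC}.\mathsf{Count}$ on its $\kappa$ registers; the coin is accepted with probability $k/\kappa$. Both counts output the number of accepted coins. *Nonadaptive unforgeability game.* A key is generated; the adversary has oracle access to $\mathsf{mint}(sk)$ and makes at most one $\mathsf{Count}$ query (to the private count, or, if the scheme has one, to the public count), submitting possibly entangled alleged coins. Let $n$ be the number of minted coins, $m$ and $m'$ the outcomes of the public and of the private count ($0$ if not queried), and $\mathit{fail}=1$ iff some verification in a public count query failed. The flexible utility is $U_{\mathrm{flex}}=m+m'-n$; the all-or-nothing utility $U_{\mathrm{aon}}$ is $m+m'-n$ if $\mathit{fail}=0$ and $-n$ otherwise. A scheme is *flexible-nonadaptive-unforgeable* if for every quantum polynomial-time adversary $\Pr[U_{\mathrm{flex}}>0]$ is at most a negligible function, and *all-or-nothing-nonadaptive-rationally-unforgeable* if for every quantum polynomial-time adversary $\mathbb E[U_{\mathrm{aon}}]$ is at most a negligible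 function. The *unconditional* versions quantify instead over all computationally unbounded adversaries that take and submit at most polynomially many coins. **Proposition.** Suppose that $\mathsf{Pr\text{-}QC}.\mathsf{verify}(sk,\cdot)$ is a rank-$1$ projective measurement for every $sk$, and let $c>1$. 1. If $\mathsf{Pr\text{-}QC}$ is flexible-nonadaptive-unforgeable, then $\mathsf{Pk\text{-}QC}$ is all-or-nothing-nonadaptive-rationally-unforgeable. 2. If $\mathsf{Pr\text{-}QC}$ is unconditionally flexible-nonadaptive-unforgeable, then $\mathsf{Pk\text{-}QC}$ is unconditionally all-or-nothing-nonadaptive-rationally-unforgeable. Both hold whether or not the algorithms of $\mathsf{Pr\text{-}QC}$ are efficient. -/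

import Mathlib

open scoped Matrix BigOperators ComplexOrder

universe u

noncomputable section

namespace QuantumCoin

/-! ### Qubits, operators on some of the qubits, and coins in the memory -/

/-- (Not necessarily normalised) pure states of a system of qubits labelled by `W`. -/
abbrev State (W : Type) [Fintype W] : Type := EuclideanSpace ℂ (W → Bool)

/-- Operators on the qubits labelled by `W`, as matrices in the computational basis. -/
abbrev Op (W : Type) : Type := Matrix (W → Bool) (W → Bool) ℂ

/-- Apply an operator to a state. -/
def applyOp {W : Type} [Fintype W] [DecidableEq W] (A : Op W) (ψ : State W) : State W :=
  WithLp.toLp 2 (A *ᵥ ψ.ofLp)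

open scoped Classical in
/-- `M ⊗ 1`: the operator `M` acting on the qubits `e 0, …, e (k - 1)`, and the identity on all
other qubits. -/
def onWires {k : ℕ} {W : Type} (e : Fin k ↪ W) (M : Op (Fin k)) : Op W :=
  fun x y => if ∀ w, w ∉ Set.range e → x w = y w then M (x ∘ e) (y ∘ e) else 0

/-- The content of the `i`-th of `m` consecutive blocks of `s` qubits. -/
def block {m s : ℕ} (x : Fin (m * s) → Bool) (i : Fin m) : Fin s → Bool :=
  fun b => x (finProdFinEquiv (i, b))

/-- The tensor product of operators on `m` consecutive blocks of `s` qubits. -/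
def tensorOp {m s : ℕ} (F : Fin m → Op (Fin s)) : Op (Fin (m * s)) :=
  fun x y => ∏ i, F i (block x i) (block y i)

/-- The joint state `φ ⊗ ψ`. -/
def tensorState {V W : Type} [Fintype V] [Fintype W] (φ : State V) (ψ : State W) :
    State (V ⊕ W) :=
  WithLp.toLp 2 fun x => φ (x ∘ Sum.inl) * ψ (x ∘ Sum.inr)

/-- The embedding of the first `ℓ / s` blocks of `s` qubits into `ℓ` qubits; it is onto as soon as
`s` divides `ℓ`. -/
def blocksEmb (ℓ s : ℕ) : Fin (ℓ / s * s) ↪ Fin ℓ :=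
  Fin.castLEEmb (Nat.div_mul_le_self ℓ s)

/-- `ℓ / s` copies of a coin `φ` of `s` qubits, stored in `ℓ` qubits (qubits that are left over,
which there are none of if `s` divides `ℓ`, are in the state `|0⟩`). -/
def coins {s : ℕ} (φ : State (Fin s)) (ℓ : ℕ) : State (Fin ℓ) :=
  WithLp.toLp 2 fun x =>
    if ∀ i : Fin ℓ, ℓ / s * s ≤ i → x i = false then
      ∏ i : Fin (ℓ / s), φ (block (x ∘ blocksEmb ℓ s) i)
    else 0

/-- The state `|0 ⋯ 0⟩`. -/
def zeros (ℓ : ℕ) : State (Fin ℓ) :=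
  EuclideanSpace.single (fun _ => false) 1

/-- Append `ℓ` qubits in the state `φ` to a memory of `N` qubits in the state `ψ`. -/
def append {N ℓ : ℕ} (ψ : State (Fin N)) (φ : State (Fin ℓ)) : State (Fin (N + ℓ)) :=
  WithLp.toLp 2 fun x => ψ (x ∘ Fin.castAdd ℓ) * φ (x ∘ Fin.natAdd N)

/-- The unnormalised state after the qubit `c` was measured in the computational basis with
outcome `b`; the squared norm is the probability of this outcome. -/
def measured {N : ℕ} (c : Fin N) (b : Bool) (ψ : State (Fin N)) : State (Fin N) :=
  WithLp.toLp 2 fun x => if x c = b then ψ x else 0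

/-! ### Adversaries -/

/-- The strategy of a nonadaptive adversary, for one value of the security parameter, from a point
on at which its memory consists of `N` qubits. It applies unitaries, calls the mint and makes at
most one `Count` query, with which the run ends (all that it could still do in the game is to take
further coins from the mint, which lowers its utility). Whether an oracle is called at all is decided by
measuring a qubit `c` of the memory, with the outcome `1` for a call, so that the number of minted
coins, the number of submitted coins and the kind of `Count` query can depend on measurement
outcomes. -/
inductive Program : ℕ → Type
  /-- End of the run, without a `Count` query. -/
  | halt {N : ℕ} : Program N
  /-- Apply a unitary to the memory. -/
  | gate {N : ℕ} (U : Matrix.unitaryGroup (Fin N → Bool) ℂ) (rest : Program N) : Program N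
  /-- Append `ℓ` qubits. They contain freshly minted coins, one in each block of the size of a
  coin, if the outcome of measuring `c` is `1`, and `|0 ⋯ 0⟩` otherwise. -/
  | mint {N : ℕ} (c : Fin N) (ℓ : ℕ) (rest : Program (N + ℓ)) : Program N
  /-- If the outcome of measuring `c` is `1`, then submit the `ℓ` qubits `ws` as alleged coins, one
  in each block of the size of a coin, and end the run; they are counted with the public
  verification if `pub` is true and with the private one otherwise. -/
  | submit {N : ℕ} (c : Fin N) (pub : Bool) {ℓ : ℕ} (ws : Fin ℓ ↪ Fin N) (rest : Program N) :
      Program N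

/-- All oracle calls transfer whole numbers of coins, of `s` qubits each. -/
def Program.WellFormed (s : ℕ) : {N : ℕ} → Program N → Prop
  | _, .halt => True
  | _, .gate _ rest => rest.WellFormed s
  | _, .mint _ ℓ rest => s ∣ ℓ ∧ rest.WellFormed s
  | _, .submit (ℓ := ℓ) _ _ _ rest => s ∣ ℓ ∧ rest.WellFormed s

/-- The total number of coins in the mint calls of a program. -/
def Program.minted (s : ℕ) : {N : ℕ} → Program N → ℕ
  | _, .halt => 0
  | _, .gate _ rest => rest.minted s
  | _, .mint _ ℓ rest => ℓ / s + rest.minted s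
  | _, .submit _ _ _ rest => rest.minted s

/-- The largest number of coins in a `Count` query of a program. -/
def Program.submitted (s : ℕ) : {N : ℕ} → Program N → ℕ
  | _, .halt => 0
  | _, .gate _ rest => rest.submitted s
  | _, .mint _ _ rest => rest.submitted s
  | _, .submit (ℓ := ℓ) _ _ _ rest => max (ℓ / s) (rest.submitted s)

/-- A nonadaptive adversary: for each security parameter a number of qubits, which are initially in
the state `|0 ⋯ 0⟩`, and a program. -/
structure Adversary where
  width : ℕ → ℕ
  program : ∀ sec, Program (width sec)

/-! ### Circuits over the gate set Hadamard, `T`, CNOT, and quantum polynomial time -/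

/-- The Hadamard gate. -/
def hadamardOp : Op (Fin 1) :=
  fun x y => if x 0 = true ∧ y 0 = true then -((√2 : ℝ) : ℂ)⁻¹ else ((√2 : ℝ) : ℂ)⁻¹

/-- The `T` gate `diag(1, e^{iπ/4})`. -/
def tOp : Op (Fin 1) :=
  Matrix.diagonal fun x => if x 0 = true then Complex.exp (Real.pi / 4 * Complex.I) else 1

/-- The controlled-NOT gate: `|a, b⟩ ↦ |a, a ⊕ b⟩`. -/
def cnotOp : Op (Fin 2) :=
  fun x y => if x 0 = y 0 ∧ x 1 = xor (y 0) (y 1) then 1 else 0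

/-- A single qubit. -/
def wire {N : ℕ} (i : Fin N) : Fin 1 ↪ Fin N :=
  ⟨fun _ => i, fun _ _ _ => Subsingleton.elim _ _⟩

/-- A pair of distinct qubits. -/
def wirePair {N : ℕ} (i j : Fin N) (h : i ≠ j) : Fin 2 ↪ Fin N :=
  ⟨![i, j], by
    intro a b hab
    fin_cases a <;> fin_cases b <;> simp_all [eq_comm]⟩

lemma onWires_one {k : ℕ} {W : Type} [Fintype W] [DecidableEq W] (e : Fin k ↪ W) :
    onWires e (1 : Op (Fin k)) = 1 := by
  classical
  ext x y
  by_cases hxy : x = y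
  · subst hxy; simp [onWires]
  · rw [Matrix.one_apply_ne hxy]
    unfold onWires
    split_ifs with h
    · refine Matrix.one_apply_ne fun h' => hxy (funext fun w => ?_)
      by_cases hw : w ∈ Set.range e
      · obtain ⟨i, rfl⟩ := hw
        exact congrFun h' i
      · exact h w hw
    · rfl

lemma onWires_mul {k : ℕ} {W : Type} [Fintype W] [DecidableEq W] (e : Fin k ↪ W)
    (A B : Op (Fin k)) : onWires e (A * B) = onWires e A * onWires e B := by
  classical
  ext x y
  have key : ∑ z : W → Bool, onWires e A x z * onWires e B z y =
      ∑ v : Fin k → Bool, onWires e A x (Function.extend e v x) *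
        onWires e B (Function.extend e v x) y := by
    symm
    refine Finset.sum_of_injOn (fun v => Function.extend e v x) ?_ ?_ ?_ ?_
    · intro v _ v' _ h
      funext i
      have := congrFun h (e i)
      simpa [e.injective.extend_apply] using this
    · intro v _; simp
    · intro z _ hz
      have : onWires e A x z = 0 := by
        unfold onWires
        rw [if_neg]
        intro h
        apply hz
        refine ⟨z ∘ e, by simp, ?_⟩
        funext w
        by_cases hw : w ∈ Set.range e
        · obtain ⟨i, rfl⟩ := hw
          simp [e.injective.extend_apply]
        · have hw' : ¬ ∃ i, e i = w := hw
          simp only [Function.extend_apply' _ _ _ hw', h w hw]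
      rw [this, zero_mul]
    · intro v _; rfl
  have hoff : ∀ (v : Fin k → Bool) w, w ∉ Set.range e → Function.extend e v x w = x w := by
    intro v w hw
    exact Function.extend_apply' _ _ _ hw
  have hon : ∀ v : Fin k → Bool, Function.extend e v x ∘ e = v := by
    intro v; funext i; simp [e.injective.extend_apply]
  rw [Matrix.mul_apply, key]
  unfold onWires
  simp only [hon]
  by_cases h : ∀ w, w ∉ Set.range e → x w = y w
  · rw [if_pos h, Matrix.mul_apply]
    refine Finset.sum_congr rfl fun v _ => ?_
    rw [if_pos (fun w hw => (hoff v w hw).symm), if_pos (fun w hw => (hoff v w hw).trans (h w hw))]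
  · rw [if_neg h]
    refine (Finset.sum_eq_zero fun v _ => ?_).symm
    have : ¬ ∀ w, w ∉ Set.range e → Function.extend e v x w = y w :=
      fun h' => h fun w hw => (hoff v w hw).symm.trans (h' w hw)
    rw [if_neg this, mul_zero]

lemma onWires_star {k : ℕ} {W : Type} [Fintype W] [DecidableEq W] (e : Fin k ↪ W)
    (A : Op (Fin k)) : onWires e (star A) = star (onWires e A) := by
  classical
  ext x y
  simp only [onWires, Matrix.star_apply]
  simp only [eq_comm (a := y _)]
  split_ifs <;> simp

lemma onWires_mem_unitary {k : ℕ} {W : Type} [Fintype W] [DecidableEq W] (e : Fin k ↪ W)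
    {A : Op (Fin k)} (hA : A ∈ Matrix.unitaryGroup (Fin k → Bool) ℂ) :
    onWires e A ∈ Matrix.unitaryGroup (W → Bool) ℂ := by
  rw [Matrix.mem_unitaryGroup_iff] at hA ⊢
  rw [← onWires_star, ← onWires_mul, hA, onWires_one]

lemma hadamardOp_mem : hadamardOp ∈ Matrix.unitaryGroup (Fin 1 → Bool) ℂ := by
  have h2 : ((√2 : ℝ) : ℂ)⁻¹ * ((√2 : ℝ) : ℂ)⁻¹ = 1 / 2 := by
    rw [← mul_inv, ← Complex.ofReal_mul, Real.mul_self_sqrt (by norm_num)]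
    norm_num
  have hsum : ∀ f : (Fin 1 → Bool) → ℂ, ∑ x, f x = f (fun _ => true) + f (fun _ => false) := by
    intro f
    rw [← (Equiv.funUnique (Fin 1) Bool).symm.sum_comp, Fintype.sum_bool]
    rfl
  rw [Matrix.mem_unitaryGroup_iff]
  ext x y
  rw [Matrix.mul_apply, hsum]
  have hx : x = fun _ => x 0 := funext fun i => by rw [Subsingleton.elim i 0]
  have hy : y = fun _ => y 0 := funext fun i => by rw [Subsingleton.elim i 0]
  rw [hx, hy]
  rcases x 0 with _ | _ <;> rcases y 0 with _ | _ <;>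
    simp [hadamardOp, funext_iff, Complex.conj_ofReal, h2] <;> norm_num

lemma tOp_mem : tOp ∈ Matrix.unitaryGroup (Fin 1 → Bool) ℂ := by
  rw [Matrix.mem_unitaryGroup_iff, tOp, Matrix.star_eq_conjTranspose,
    Matrix.diagonal_conjTranspose, Matrix.diagonal_mul_diagonal, ← Matrix.diagonal_one]
  congr 1
  funext x
  rcases h : x 0 with _ | _
  · simp [h]
  · simp only [h, Pi.star_apply, if_true, Complex.star_def, ← Complex.exp_conj, ← Complex.exp_add]
    simp [Complex.conj_ofReal, map_ofNat]

lemma cnotOp_mem : cnotOp ∈ Matrix.unitaryGroup (Fin 2 → Bool) ℂ := by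
  have hsum : ∀ f : (Fin 2 → Bool) → ℂ, ∑ x, f x =
      f ![true, true] + f ![true, false] + (f ![false, true] + f ![false, false]) := by
    intro f
    rw [← (finTwoArrowEquiv Bool).symm.sum_comp, Fintype.sum_prod_type, Fintype.sum_bool,
      Fintype.sum_bool, Fintype.sum_bool]
    rfl
  rw [Matrix.mem_unitaryGroup_iff]
  ext x y
  rw [Matrix.mul_apply, hsum]
  have hx : x = ![x 0, x 1] := by funext i; fin_cases i <;> rfl
  have hy : y = ![y 0, y 1] := by funext i; fin_cases i <;> rfl
  rw [hx, hy]
  rcases x 0 with _ | _ <;> rcases x 1 with _ | _ <;> rcases y 0 with _ | _ <;>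
    rcases y 1 with _ | _ <;> simp [cnotOp, funext_iff, Fin.forall_fin_two]

/-- Circuits of gates of the universal set Hadamard, `T`, CNOT, and of oracle calls as in
`Program`. -/
inductive Circuit : ℕ → Type
  | halt {N : ℕ} : Circuit N
  | hadamard {N : ℕ} (i : Fin N) (rest : Circuit N) : Circuit N
  | tGate {N : ℕ} (i : Fin N) (rest : Circuit N) : Circuit N
  | cnot {N : ℕ} (i j : Fin N) (h : i ≠ j) (rest : Circuit N) : Circuit N
  | mint {N : ℕ} (c : Fin N) (ℓ : ℕ) (rest : Circuit (N + ℓ)) : Circuit N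
  | submit {N : ℕ} (c : Fin N) (pub : Bool) {ℓ : ℕ} (ws : Fin ℓ ↪ Fin N) (rest : Circuit N) :
      Circuit N

/-- The strategy that a circuit describes. -/
def Circuit.toProgram : {N : ℕ} → Circuit N → Program N
  | _, .halt => .halt
  | _, .hadamard i rest =>
      .gate ⟨onWires (wire i) hadamardOp, onWires_mem_unitary _ hadamardOp_mem⟩ rest.toProgram
  | _, .tGate i rest =>
      .gate ⟨onWires (wire i) tOp, onWires_mem_unitary _ tOp_mem⟩ rest.toProgram
  | _, .cnot i j h rest =>
      .gate ⟨onWires (wirePair i j h) cnotOp, onWires_mem_unitary _ cnotOp_mem⟩ rest.toProgram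
  | _, .mint c ℓ rest => .mint c ℓ rest.toProgram
  | _, .submit c pub ws rest => .submit c pub ws rest.toProgram

/-- Self-delimiting unary code of a number. -/
def unary (n : ℕ) : List Bool := List.replicate n true ++ [false]

/-- The description of a circuit as a bit string. -/
def Circuit.encode : {N : ℕ} → Circuit N → List Bool
  | _, .halt => unary 0
  | _, .hadamard i rest => unary 1 ++ unary i ++ rest.encode
  | _, .tGate i rest => unary 2 ++ unary i ++ rest.encode
  | _, .cnot i j _ rest => unary 3 ++ unary i ++ unary j ++ rest.encode
  | _, .mint c ℓ rest => unary 4 ++ unary c ++ unary ℓ ++ rest.encode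
  | _, .submit (ℓ := ℓ) c pub ws rest =>
      unary 5 ++ unary c ++ [pub] ++ unary ℓ ++
        (List.ofFn fun i => unary (ws i)).flatten ++ rest.encode

/-- The description of a circuit together with its initial number of qubits. -/
def describe (C : Σ N, Circuit N) : List Bool := unary C.1 ++ C.2.encode

/-- Quantum polynomial-time adversaries against coins of `s` qubits: the strategies are given by a
uniform family of circuits, i.e. a deterministic Turing machine computes, from the security
parameter in unary, a description of the circuit in polynomial time. (That the descriptions have
polynomial length is a consequence, which is recorded for convenience.) -/
def IsQPT (s : ℕ → ℕ) (A : Adversary) : Prop :=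
  (∀ sec, (A.program sec).WellFormed (s sec)) ∧
  ∃ C : ∀ sec, Circuit (A.width sec),
    (∀ sec, A.program sec = (C sec).toProgram) ∧
    (∃ p : Polynomial ℕ, ∀ sec, (describe ⟨_, C sec⟩).length ≤ p.eval sec) ∧
    Nonempty (Turing.TM2ComputableInPolyTime Computability.unaryEncodeNat
      (id : List Bool → List Bool) fun sec => describe ⟨_, C sec⟩)

/-- Unbounded adversaries against coins of `s` qubits: arbitrary strategies, restricted only in
that the numbers of coins taken from the mint and submitted are polynomial. -/
def IsUnbounded (s : ℕ → ℕ) (A : Adversary) : Prop :=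
  (∀ sec, (A.program sec).WellFormed (s sec)) ∧
  ∃ p : Polynomial ℕ, ∀ sec,
    (A.program sec).minted (s sec) ≤ p.eval sec ∧
    (A.program sec).submitted (s sec) ≤ p.eval sec

/-! ### Coin schemes and the unforgeability game -/

/-- A procedure that verifies `m` alleged coins of `s` qubits, located at the qubits `e` of a
memory in the state `ψ`, one by one; its value at `o : Fin m → Bool` is the probability that coin
`i` is accepted exactly if `o i = true`. For an unnormalised `ψ` the probabilities are multiplied
with `‖ψ‖ ^ 2`. -/
abbrev Verification (s : ℕ) : Type :=
  ∀ {N m : ℕ}, (Fin (m * s) ↪ Fin N) → State (Fin N) → (Fin m → Bool) → ℝ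

/-- A (stateless) quantum coin scheme, as seen by an adversary in the unforgeability game. A private
scheme has no public verification. -/
structure CoinScheme where
  /-- The secret keys. -/
  Key : ℕ → Type u
  [measurableKey : ∀ sec, MeasurableSpace (Key sec)]
  /-- The distribution of the secret key. -/
  keyGen : ∀ sec, MeasureTheory.Measure (Key sec)
  /-- The number of qubits of a coin. -/
  size : ℕ → ℕ
  /-- The coin that the mint prepares. -/
  coin : ∀ sec, Key sec → State (Fin (size sec))
  verifySk : ∀ sec, Key sec → Verification (size sec)
  verifyPk : Option (∀ sec, Key sec → Verification (size sec))

attribute [instance] CoinScheme.measurableKey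

/-- The outcome of the unforgeability game. -/
structure Outcome where
  /-- The outcome of the public count. -/
  m : ℕ
  /-- The outcome of the private count. -/
  m' : ℕ
  /-- The number of coins taken from the mint. -/
  n : ℕ
  /-- Whether there was a failed verification in a public count. -/
  fail : Prop

/-- The number of accepted coins. -/
def count {m : ℕ} (o : Fin m → Bool) : ℕ := (Finset.univ.filter fun i => o i = true).card

/-- The expectation of `f` of the outcome of the game for a fixed secret key, from the point on at
which the program `P` remains to be run, the memory is in the state `ψ` and `n` coins have been
minted. A scheme without public verification answers all `Count` queries with the private count. -/
def runFrom {s : ℕ} (coin : State (Fin s)) (sk : Verification s) (pk : Option (Verification s))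
    (f : Outcome → ℝ) : {N : ℕ} → Program N → State (Fin N) → ℕ → ℝ
  | _, .halt, ψ, n => ‖ψ‖ ^ 2 * f ⟨0, 0, n, False⟩
  | _, .gate U rest, ψ, n => runFrom coin sk pk f rest (applyOp U.1 ψ) n
  | _, .mint c ℓ rest, ψ, n =>
      runFrom coin sk pk f rest (append (measured c true ψ) (coins coin ℓ)) (n + ℓ / s) +
      runFrom coin sk pk f rest (append (measured c false ψ) (zeros ℓ)) n
  | _, .submit (ℓ := ℓ) c pub ws rest, ψ, n =>
      (match pk, pub with
        | some V, true => ∑ o : Fin (ℓ / s) → Bool,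
            V ((blocksEmb ℓ s).trans ws) (measured c true ψ) o *
              f ⟨count o, 0, n, ∃ i, o i = false⟩
        | _, _ => ∑ o : Fin (ℓ / s) → Bool,
            sk ((blocksEmb ℓ s).trans ws) (measured c true ψ) o *
              f ⟨0, count o, n, False⟩) +
      runFrom coin sk pk f rest (measured c false ψ) n

/-- The expectation of `f` of the outcome of the game, over the choice of the secret key and all
measurement outcomes. -/
def gameExpectation (M : CoinScheme.{u}) (A : Adversary) (sec : ℕ) (f : Outcome → ℝ) : ℝ :=
  ∫ sk, runFrom (M.coin sec sk) (M.verifySk sec sk) (M.verifyPk.map fun V => V sec sk) f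
    (A.program sec) (zeros (A.width sec)) 0 ∂(M.keyGen sec)

open scoped Classical in
/-- The probability that the outcome of the game has the property `E`. -/
def gameProbability (M : CoinScheme.{u}) (A : Adversary) (sec : ℕ) (E : Outcome → Prop) : ℝ :=
  gameExpectation M A sec fun r => if E r then 1 else 0

/-- The flexible utility. -/
def flexibleUtility (r : Outcome) : ℝ := r.m + r.m' - r.n

open scoped Classical in
/-- The all-or-nothing utility. -/
def allOrNothingUtility (r : Outcome) : ℝ :=
  if r.fail then -r.n else r.m + r.m' - r.n

/-- Negligible functions of the security parameter. -/
def Negligible (ε : ℕ → ℝ) : Prop :=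
  Asymptotics.SuperpolynomialDecay Filter.atTop (fun sec : ℕ => (sec : ℝ)) ε

/-- Standard unforgeability in the nonadaptive game against the adversaries in `𝒜`. -/
def StandardUnforgeable (M : CoinScheme.{u}) (𝒜 : (ℕ → ℕ) → Adversary → Prop)
    (U : Outcome → ℝ) : Prop :=
  ∀ A, 𝒜 M.size A →
    ∃ ε, Negligible ε ∧ ∀ sec, gameProbability M A sec (fun r => 0 < U r) ≤ ε sec

/-- Rational unforgeability in the nonadaptive game against the adversaries in `𝒜`. -/
def RationallyUnforgeable (M : CoinScheme.{u}) (𝒜 : (ℕ → ℕ) → Adversary → Prop)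
    (U : Outcome → ℝ) : Prop :=
  ∀ A, 𝒜 M.size A → ∃ ε, Negligible ε ∧ ∀ sec, gameExpectation M A sec U ≤ ε sec

/-- Flexible nonadaptive unforgeability. -/
def FlexibleNonadaptiveUnforgeable (M : CoinScheme.{u})
    (𝒜 : (ℕ → ℕ) → Adversary → Prop) : Prop :=
  StandardUnforgeable M 𝒜 flexibleUtility

/-- All-or-nothing nonadaptive rational unforgeability. -/
def AllOrNothingNonadaptiveRationallyUnforgeable (M : CoinScheme.{u})
    (𝒜 : (ℕ → ℕ) → Adversary → Prop) : Prop :=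
  RationallyUnforgeable M 𝒜 allOrNothingUtility

/-! ### Private coin schemes -/

/-- The effect (POVM element) of the event that the verifications of `m` alleged coins, each of
which accepts with effect `E`, have the results `o`. -/
def resultsEffect {s : ℕ} (E : Op (Fin s)) {m : ℕ} (o : Fin m → Bool) : Op (Fin (m * s)) :=
  tensorOp fun i => if o i = true then E else 1 - E

/-- The verification of coins one by one, each of which is accepted with effect `E`. -/
def verificationOf {s : ℕ} (E : Op (Fin s)) : Verification s :=
  fun e ψ o => (inner ℂ ψ (applyOp (onWires e (resultsEffect E o)) ψ)).re

/-- A private quantum coin scheme, not necessarily efficient, with perfect completeness. -/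
structure PrivateCoinScheme where
  /-- The secret keys. -/
  Key : ℕ → Type u
  [measurableKey : ∀ sec, MeasurableSpace (Key sec)]
  /-- The distribution of the secret key. -/
  keyGen : ∀ sec, MeasureTheory.Measure (Key sec)
  [isProbabilityMeasure : ∀ sec, MeasureTheory.IsProbabilityMeasure (keyGen sec)]
  /-- The number of qubits of a coin. -/
  qubits : ℕ → ℕ
  qubits_pos : ∀ sec, 0 < qubits sec
  /-- The pure state that the mint prepares. -/
  coin : ∀ sec, Key sec → State (Fin (qubits sec))
  norm_coin : ∀ sec sk, ‖coin sec sk‖ = 1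
  measurable_coin : ∀ sec x, Measurable fun sk => coin sec sk x
  /-- The effect (POVM element) with which the verification accepts. -/
  verify : ∀ sec, Key sec → Op (Fin (qubits sec))
  verify_nonneg : ∀ sec sk, (verify sec sk).PosSemidef
  verify_le_one : ∀ sec sk, (1 - verify sec sk).PosSemidef
  measurable_verify : ∀ sec x y, Measurable fun sk => verify sec sk x y
  complete : ∀ sec, ∀ᵐ sk ∂(keyGen sec),
    inner ℂ (coin sec sk) (applyOp (verify sec sk) (coin sec sk)) = 1

attribute [instance] PrivateCoinScheme.measurableKey PrivateCoinScheme.isProbabilityMeasure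

namespace PrivateCoinScheme

/-- The verification is a rank-one projective measurement. -/
def IsRankOneProjective (Pr : PrivateCoinScheme.{u}) : Prop :=
  ∀ sec sk, IsStarProjection (Pr.verify sec sk) ∧ (Pr.verify sec sk).rank = 1

/-- A private coin scheme in the unforgeability game. -/
def toCoinScheme (Pr : PrivateCoinScheme.{u}) : CoinScheme.{u} where
  Key := Pr.Key
  keyGen := Pr.keyGen
  size := Pr.qubits
  coin := Pr.coin
  verifySk sec sk := verificationOf (Pr.verify sec sk)
  verifyPk := none

end PrivateCoinScheme

/-! ### The public coin scheme -/

/-- The states in which the registers in `R` are in the symmetric subspace: they are invariant under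
all permutations of the registers in `R`. Register `i` consists of the qubits `reg i`. -/
def symmetricSubspace {ι V : Type} [Fintype V] {q : ℕ} (reg : ι → Fin q → V) (R : Set ι) :
    Submodule ℂ (State V) where
  carrier := {ψ | ∀ σ : Equiv.Perm ι, (∀ i, i ∉ R → σ i = i) → ∀ x y : V → Bool,
    (∀ i b, y (reg i b) = x (reg (σ i) b)) → (∀ v, (∀ i b, reg i b ≠ v) → y v = x v) →
      ψ y = ψ x}
  zero_mem' := by intro σ _ x y _ _; rfl
  add_mem' := by
    intro ψ φ hψ hφ σ hσ x y h₁ h₂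
    simp [hψ σ hσ x y h₁ h₂, hφ σ hσ x y h₁ h₂]
  smul_mem' := by
    intro a ψ hψ σ hσ x y h₁ h₂
    simp [hψ σ hσ x y h₁ h₂]

/-- The registers, of `q` qubits each, of a wallet that holds one public coin of `κ` registers and of
`m` alleged public coins: register `(none, r)` is in the initial coin of the wallet, and register
`(some i, r)` is in the alleged coin `i`. -/
def registers {κ q N m : ℕ} (e : Fin (m * (κ * q)) ↪ Fin N) :
    Option (Fin m) × Fin κ → Fin q → Fin (κ * q) ⊕ Fin N
  | (none, r), b => Sum.inl (finProdFinEquiv (r, b))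
  | (some i, r), b => Sum.inr (e (finProdFinEquiv (i, finProdFinEquiv (r, b))))

/-- The projection onto the symmetric subspace of the registers of the wallet, after it has absorbed
the alleged coins before coin `i`, and of the alleged coin `i`. -/
def symmetricProjection {κ q N m : ℕ} (e : Fin (m * (κ * q)) ↪ Fin N) (i : Fin m) :
    State (Fin (κ * q) ⊕ Fin N) →L[ℂ] State (Fin (κ * q) ⊕ Fin N) :=
  (symmetricSubspace (registers e) {r | ∀ j, r.1 = some j → j ≤ i}).starProjection

/-- The public verification: a wallet is initialised with a fresh public coin; then, for each alleged
coin in turn, the registers of the wallet and of that coin are measured with the two outcomes "in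
the symmetric subspace" (accept) and "orthogonal to it" (reject), and the post-measurement state is
the new state of the wallet, to which the alleged coin now belongs. -/
def publicVerification {κ q : ℕ} (cent : State (Fin (κ * q))) : Verification (κ * q) :=
  fun {_ m} e ψ o =>
    ‖(List.finRange m).foldl
      (fun χ i => if o i = true then symmetricProjection e i χ else χ - symmetricProjection e i χ)
      (tensorState cent ψ)‖ ^ 2

/-- The effect with which the bank accepts a public coin: the private coins in it are verified, and
if `k` of these verifications accept, then the public coin is accepted with probability `k / κ`. -/
def bankEffect {q : ℕ} (κ : ℕ) (E : Op (Fin q)) : Op (Fin (κ * q)) :=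
  ∑ o : Fin κ → Bool, ((count o : ℂ) / κ) • resultsEffect E o

/-- The public coin scheme in which a public coin consists of `κ` private coins. -/
def PrivateCoinScheme.publicScheme (Pr : PrivateCoinScheme.{u}) (κ : ℕ → ℕ) : CoinScheme.{u} where
  Key := Pr.Key
  keyGen := Pr.keyGen
  size sec := κ sec * Pr.qubits sec
  coin sec sk := coins (Pr.coin sec sk) (κ sec * Pr.qubits sec)
  verifySk sec sk := verificationOf (bankEffect (κ sec) (Pr.verify sec sk))
  verifyPk := some fun sec sk =>
    publicVerification (coins (Pr.coin sec sk) (κ sec * Pr.qubits sec))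

/-- `(log₂ λ) ^ c`, rounded up. -/
def kappa (c : ℝ) (sec : ℕ) : ℕ := ⌈Real.logb 2 sec ^ c⌉₊

end QuantumCoin

end

noncomputable section

namespace QuantumCoin

/-! ### Applying operators -/

section applyOp

variable {W : Type} [Fintype W] [DecidableEq W]

/-! The reduction runs the very same program against both schemes. A public coin is a block of `κ`
private coins (`coins_coins`), so a run that has minted `n` public coins is, in the private game, a
run that has minted `κ * n` private coins, and the `m` submitted public coins are `m * κ` submitted
private coins. With `M` a bound on the number of submitted public coins, the claim for each key is
that the expected all-or-nothing utility is at most `2 ^ (1 - κ) + M * p`, where `p` is the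
probability that the program has positive flexible utility in the private game
(`runFrom_public_le`). For `κ = ⌈(log₂ λ) ^ c⌉` with `c > 1` the first term is negligible, and `M`
is polynomial.

Everything but the counts is common to both games, so a single `Count` query has to be analysed, say
with `n` coins minted and `m` submitted. Let the hits be the number of submitted private registers
that the private verification would accept. More than `κ * n` hits is exactly a win in the private
game, and on this event the utility is at most `m`. It remains to treat at most `κ * n` hits. For
the bank count the expected number of accepted coins is then `hits / κ ≤ n`, so there is no gain
(`sum_bank_le`).

For the public count, passing all tests amounts to projecting `v = ¢ ⊗ ψ` onto the symmetric
subspace of all `(m + 1) * κ` registers, because the tests project onto a decreasing chain of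
subspaces. Let `w` be the projected state. The private verification results of `w` are exchangeable
bits, so if at most `(n + 1) * κ` of them are `1`, then the `κ` wallet positions are all `1` for at
most a fraction `r = ((n + 1) / (m + 1)) ^ κ` of the weight (`sum_allTrue_le`). In `v` the wallet is
accepted with certainty. Let `Q` be the projector of the event of at most `(n + 1) * κ` hits, wallet
included. It preserves symmetry, so `‖Q w‖² = ⟨w, Q w⟩ = ⟨v, Q w⟩`, and only results with an
accepted wallet contribute to the last inner product. Cauchy–Schwarz gives `‖Q w‖² ≤ ‖Q v‖ * √r * ‖Q
w‖`, hence `‖Q w‖² ≤ r * ‖Q v‖²` (`sum_registersProb_le`). Thus few hits pass all tests with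
probability at most `r`, and `m * r - n ≤ 2 ^ (1 - κ)` is elementary (`mul_pow_div_sub_le`). -/

lemma applyOp_apply (A : Op W) (ψ : State W) (x : W → Bool) :
    applyOp A ψ x = ∑ y, A x y * ψ y := rfl

lemma applyOp_one (ψ : State W) : applyOp 1 ψ = ψ := by
  simp [applyOp]

lemma applyOp_mul (A B : Op W) (ψ : State W) :
    applyOp (A * B) ψ = applyOp A (applyOp B ψ) := by
  simp [applyOp, Matrix.mulVec_mulVec]

lemma applyOp_sum {ι : Type*} (s : Finset ι) (A : ι → Op W) (ψ : State W) :
    applyOp (∑ i ∈ s, A i) ψ = ∑ i ∈ s, applyOp (A i) ψ := by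
  ext x
  simp only [applyOp_apply, Matrix.sum_apply, Finset.sum_mul, WithLp.ofLp_sum, Finset.sum_apply]
  rw [Finset.sum_comm]

lemma applyOp_smul (a : ℂ) (A : Op W) (ψ : State W) :
    applyOp (a • A) ψ = a • applyOp A ψ := by
  ext x
  simp [applyOp_apply, Finset.mul_sum, mul_assoc]

lemma inner_applyOp (A : Op W) (φ ψ : State W) :
    inner ℂ φ (applyOp A ψ) = inner ℂ (applyOp (star A) φ) ψ := by
  simp only [PiLp.inner_apply, applyOp_apply, RCLike.inner_apply, map_sum, map_mul,
    Matrix.star_apply, Finset.sum_mul, Finset.mul_sum]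
  rw [Finset.sum_comm]
  refine Finset.sum_congr rfl fun y _ => Finset.sum_congr rfl fun x _ => ?_
  simp
  ring

lemma norm_applyOp_unitary (U : Matrix.unitaryGroup (W → Bool) ℂ) (ψ : State W) :
    ‖applyOp U.1 ψ‖ = ‖ψ‖ := by
  have h : inner ℂ (applyOp U.1 ψ) (applyOp U.1 ψ) = inner ℂ ψ ψ := by
    rw [inner_applyOp, ← applyOp_mul, Unitary.coe_star_mul_self, applyOp_one]
  rw [inner_self_eq_norm_sq_to_K, inner_self_eq_norm_sq_to_K] at h
  have h' : ‖applyOp U.1 ψ‖ ^ 2 = ‖ψ‖ ^ 2 := by exact_mod_cast h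
  exact (pow_left_inj₀ (norm_nonneg _) (norm_nonneg _) two_ne_zero).1 h'

lemma inner_applyOp_of_isStarProjection {Q : Op W} (hQ : IsStarProjection Q) (φ ψ : State W) :
    inner ℂ φ (applyOp Q ψ) = inner ℂ (applyOp Q φ) (applyOp Q ψ) := by
  have hs : star Q = Q := hQ.isSelfAdjoint
  have hm : Q * Q = Q := hQ.isIdempotentElem
  conv_lhs => rw [← hm, applyOp_mul, inner_applyOp, hs]

lemma inner_self_applyOp_of_isStarProjection {Q : Op W} (hQ : IsStarProjection Q) (ψ : State W) :
    inner ℂ ψ (applyOp Q ψ) = ((‖applyOp Q ψ‖ ^ 2 : ℝ) : ℂ) := by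
  rw [inner_applyOp_of_isStarProjection hQ, inner_self_eq_norm_sq_to_K]
  push_cast
  rfl

/-- The equality case of Cauchy–Schwarz: acceptance with certainty by a projection forces the coin
to lie in its range. -/
lemma applyOp_eq_self_of_inner_eq_one {Q : Op W} (hQ : IsStarProjection Q) {φ : State W}
    (hφ : ‖φ‖ = 1) (h : inner ℂ φ (applyOp Q φ) = 1) : applyOp Q φ = φ := by
  have hn : ‖applyOp Q φ‖ ^ 2 = 1 := by
    rw [inner_self_applyOp_of_isStarProjection hQ] at h
    exact_mod_cast h
  have hn' : ‖applyOp Q φ‖ = 1 := by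
    have := norm_nonneg (applyOp Q φ)
    nlinarith
  exact ((inner_eq_one_iff_of_norm_eq_one hφ hn').1 h).symm

end applyOp

/-! ### Product operators on registers -/

section registerOp

variable {ι V : Type} [Fintype ι] {q : ℕ}

open scoped Classical in
/-- The tensor product of the operators `F i` on the registers `reg i`, and the identity on all
other qubits. -/
def registerOp (reg : ι → Fin q → V) (F : ι → Op (Fin q)) : Op V :=
  fun x y => if ∀ v, (∀ i b, reg i b ≠ v) → x v = y v then
    ∏ i, F i (x ∘ reg i) (y ∘ reg i) else 0

lemma registerOp_comp_equiv {κ : Type} [Fintype κ] (θ : κ ≃ ι) (reg : ι → Fin q → V)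
    (F : ι → Op (Fin q)) :
    registerOp (fun k => reg (θ k)) (fun k => F (θ k)) = registerOp reg F := by
  classical
  ext x y
  unfold registerOp
  have hoff : (∀ v, (∀ k b, reg (θ k) b ≠ v) → x v = y v) ↔
      ∀ v, (∀ i b, reg i b ≠ v) → x v = y v := by
    refine forall_congr' fun v => imp_congr_left ?_
    exact θ.forall_congr_left.trans (by simp)
  rw [Fintype.prod_equiv θ _ (fun i => F i (x ∘ reg i) (y ∘ reg i)) fun _ => rfl]
  exact if_congr hoff rfl rfl

lemma registerOp_star (reg : ι → Fin q → V) (F : ι → Op (Fin q)) :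
    star (registerOp reg F) = registerOp reg fun i => star (F i) := by
  classical
  ext x y
  have hoff : (∀ v, (∀ i b, reg i b ≠ v) → y v = x v) ↔
      ∀ v, (∀ i b, reg i b ≠ v) → x v = y v :=
    forall_congr' fun v => imp_congr_right fun _ => eq_comm
  rw [Matrix.star_apply]
  unfold registerOp
  refine (apply_ite star _ _ _).trans (if_congr hoff ?_ ?_) <;> simp

/-- Distributivity of the tensor product. It yields both the resolution of the identity into
verification results and the expansion of a bank count into private verifications. -/
lemma registerOp_sum {α : Type*} [Fintype α] [DecidableEq ι] (reg : ι → Fin q → V)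
    (F : ι → α → Op (Fin q)) :
    registerOp reg (fun i => ∑ a, F i a) = ∑ O : ι → α, registerOp reg fun i => F i (O i) := by
  classical
  ext x y
  rw [Matrix.sum_apply]
  unfold registerOp
  split_ifs with h
  · simp only [Matrix.sum_apply, Finset.prod_univ_sum, Fintype.piFinset_univ]
  · simp

variable [Fintype V] [DecidableEq V] {reg : ι → Fin q → V}

lemma registerOp_one : registerOp reg (fun _ => 1) = 1 := by
  classical
  ext x y
  unfold registerOp
  by_cases hxy : x = y
  · subst hxy; simp
  · rw [Matrix.one_apply_ne hxy]
    split_ifs with h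
    · by_contra h0
      refine hxy (funext fun v => ?_)
      by_cases hv : ∀ i b, reg i b ≠ v
      · exact h v hv
      · push Not at hv
        obtain ⟨i, b, rfl⟩ := hv
        have hi := Finset.prod_ne_zero_iff.1 h0 i (Finset.mem_univ i)
        have : x ∘ reg i = y ∘ reg i := by
          by_contra hne
          exact hi (Matrix.one_apply_ne hne)
        exact congrFun this b
    · rfl

lemma registerOp_mul (hreg : Function.Injective fun p : ι × Fin q => reg p.1 p.2)
    (F G : ι → Op (Fin q)) :
    registerOp reg (fun i => F i * G i) = registerOp reg F * registerOp reg G := by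
  classical
  set r : ι × Fin q → V := fun p => reg p.1 p.2 with hr
  ext x y
  -- Only intermediate basis strings that agree with `x` off the registers contribute to the matrix
  -- product; `z ζ` is `x` with the register contents overwritten by `ζ`.
  let z : (ι → Fin q → Bool) → V → Bool := fun ζ => Function.extend r (fun p => ζ p.1 p.2) x
  have zon : ∀ ζ i, z ζ ∘ reg i = ζ i := by
    intro ζ i
    funext b
    exact hreg.extend_apply (fun p : ι × Fin q => ζ p.1 p.2) x (i, b)
  have zoff : ∀ ζ v, (∀ i b, reg i b ≠ v) → z ζ v = x v := by
    intro ζ v hv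
    exact Function.extend_apply' _ _ _ fun ⟨p, hp⟩ => hv p.1 p.2 hp
  have key : ∑ t : V → Bool, registerOp reg F x t * registerOp reg G t y =
      ∑ ζ : ι → Fin q → Bool, registerOp reg F x (z ζ) * registerOp reg G (z ζ) y := by
    symm
    refine Finset.sum_of_injOn z ?_ ?_ ?_ ?_
    · intro ζ _ ζ' _ h
      funext i
      rw [← zon ζ i, h, zon]
    · intro ζ _; simp
    · intro t _ ht
      have : registerOp reg F x t = 0 := by
        unfold registerOp
        rw [if_neg]
        intro h
        apply ht
        refine ⟨fun i => t ∘ reg i, by simp, funext fun v => ?_⟩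
        by_cases hv : ∀ i b, reg i b ≠ v
        · exact (zoff (fun i => t ∘ reg i) v hv).trans (h v hv)
        · push Not at hv
          obtain ⟨i, b, rfl⟩ := hv
          exact congrFun (zon (fun i => t ∘ reg i) i) b
      rw [this, zero_mul]
    · intro ζ _; rfl
  rw [Matrix.mul_apply, key]
  unfold registerOp
  simp only [zon]
  by_cases h : ∀ v, (∀ i b, reg i b ≠ v) → x v = y v
  · rw [if_pos h]
    simp only [Matrix.mul_apply, Finset.prod_univ_sum, Fintype.piFinset_univ]
    refine Finset.sum_congr rfl fun ζ _ => ?_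
    rw [if_pos (fun v hv => (zoff ζ v hv).symm),
      if_pos (fun v hv => (zoff ζ v hv).trans (h v hv)), Finset.prod_mul_distrib]
  · rw [if_neg h]
    refine (Finset.sum_eq_zero fun ζ _ => ?_).symm
    have : ¬ ∀ v, (∀ i b, reg i b ≠ v) → z ζ v = y v :=
      fun h' => h fun v hv => (zoff ζ v hv).symm.trans (h' v hv)
    rw [if_neg this, mul_zero]

lemma registerOp_isStarProjection (hreg : Function.Injective fun p : ι × Fin q => reg p.1 p.2)
    {F : ι → Op (Fin q)} (hF : ∀ i, IsStarProjection (F i)) :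
    IsStarProjection (registerOp reg F) where
  isIdempotentElem := by
    rw [IsIdempotentElem, ← registerOp_mul hreg]
    congr 1
    exact funext fun i => (hF i).isIdempotentElem
  isSelfAdjoint := by
    rw [IsSelfAdjoint, registerOp_star]
    congr 1
    exact funext fun i => (hF i).isSelfAdjoint

end registerOp

lemma onWires_tensorOp {m s : ℕ} {W : Type} (e : Fin (m * s) ↪ W) (F : Fin m → Op (Fin s)) :
    onWires e (tensorOp F) = registerOp (fun i b => e (finProdFinEquiv (i, b))) F := by
  classical
  ext x y
  unfold onWires registerOp
  have hoff : (∀ w, w ∉ Set.range e → x w = y w) ↔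
      ∀ v, (∀ i b, e (finProdFinEquiv (i, b)) ≠ v) → x v = y v := by
    refine forall_congr' fun v => imp_congr_left ?_
    simp only [Set.mem_range, not_exists]
    exact finProdFinEquiv.symm.forall_congr_left.trans (by simp [Prod.forall])
  simp only [hoff]
  rfl

/-! ### The distribution of the verification results -/

section registerProb

variable {ι V : Type} [Fintype ι] {q : ℕ}

/-- The effect of the result `b` of a verification which accepts with effect `E`. -/
def resultEffect (E : Op (Fin q)) (b : Bool) : Op (Fin q) := if b = true then E else 1 - E

lemma resultEffect_isStarProjection {E : Op (Fin q)} (hE : IsStarProjection E) (b : Bool) :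
    IsStarProjection (resultEffect E b) := by
  unfold resultEffect
  split_ifs
  · exact hE
  · exact hE.one_sub

/-- The effect of the event that the verifications of the registers have the results `O`. -/
def registersEffect (reg : ι → Fin q → V) (E : Op (Fin q)) (O : ι → Bool) : Op V :=
  registerOp reg fun i => resultEffect E (O i)

/-- The probability that the verifications of the registers have the results `O`, if `E` is a
projection. -/
def registersProb [Fintype V] [DecidableEq V] (reg : ι → Fin q → V) (E : Op (Fin q))
    (ψ : State V) (O : ι → Bool) : ℝ :=
  ‖applyOp (registersEffect reg E O) ψ‖ ^ 2

lemma registersProb_nonneg [Fintype V] [DecidableEq V] (reg : ι → Fin q → V) (E : Op (Fin q))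
    (ψ : State V) (O : ι → Bool) : 0 ≤ registersProb reg E ψ O := sq_nonneg _

lemma registersProb_comp_equiv [Fintype V] [DecidableEq V] {κ : Type} [Fintype κ] (θ : κ ≃ ι)
    (reg : ι → Fin q → V) (E : Op (Fin q)) (ψ : State V) (O : ι → Bool) :
    registersProb (fun k => reg (θ k)) E ψ (fun k => O (θ k)) = registersProb reg E ψ O := by
  unfold registersProb registersEffect
  rw [registerOp_comp_equiv θ reg fun i => resultEffect E (O i)]

variable [Fintype V] [DecidableEq V] {reg : ι → Fin q → V}

lemma sum_registersEffect [DecidableEq ι] (E : Op (Fin q)) :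
    ∑ O, registersEffect reg E O = 1 := by
  unfold registersEffect
  rw [← registerOp_sum reg fun _ b => resultEffect E b]
  simp [resultEffect, registerOp_one]

lemma registersEffect_isStarProjection
    (hreg : Function.Injective fun p : ι × Fin q => reg p.1 p.2) {E : Op (Fin q)}
    (hE : IsStarProjection E) (O : ι → Bool) : IsStarProjection (registersEffect reg E O) :=
  registerOp_isStarProjection hreg fun i => resultEffect_isStarProjection hE (O i)

lemma inner_registersEffect (hreg : Function.Injective fun p : ι × Fin q => reg p.1 p.2)
    {E : Op (Fin q)} (hE : IsStarProjection E) (ψ : State V) (O : ι → Bool) :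
    inner ℂ ψ (applyOp (registersEffect reg E O) ψ) = (registersProb reg E ψ O : ℂ) :=
  inner_self_applyOp_of_isStarProjection (registersEffect_isStarProjection hreg hE O) ψ

lemma sum_registersProb [DecidableEq ι]
    (hreg : Function.Injective fun p : ι × Fin q => reg p.1 p.2)
    {E : Op (Fin q)} (hE : IsStarProjection E) (ψ : State V) :
    ∑ O, registersProb reg E ψ O = ‖ψ‖ ^ 2 := by
  have h : ∑ O, inner ℂ ψ (applyOp (registersEffect reg E O) ψ) = inner ℂ ψ ψ := by
    rw [← inner_sum, ← applyOp_sum, sum_registersEffect, applyOp_one]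
  simp only [inner_registersEffect hreg hE, inner_self_eq_norm_sq_to_K] at h
  apply Complex.ofReal_injective
  push_cast
  exact h

end registerProb

/-- The registers of `s` qubits that `m` consecutive blocks form. -/
def blockRegisters {m s : ℕ} {W : Type} (e : Fin (m * s) ↪ W) : Fin m → Fin s → W :=
  fun i b => e (finProdFinEquiv (i, b))

lemma blockRegisters_injective {m s : ℕ} {W : Type} (e : Fin (m * s) ↪ W) :
    Function.Injective fun p : Fin m × Fin s => blockRegisters e p.1 p.2 :=
  fun _ _ h => finProdFinEquiv.injective (e.injective h)

lemma verificationOf_eq {s N m : ℕ} {E : Op (Fin s)} (hE : IsStarProjection E)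
    (e : Fin (m * s) ↪ Fin N) (ψ : State (Fin N)) (o : Fin m → Bool) :
    verificationOf E e ψ o = registersProb (blockRegisters e) E ψ o := by
  have : onWires e (resultsEffect E o) = registersEffect (blockRegisters e) E o :=
    onWires_tensorOp e _
  rw [verificationOf, this, inner_registersEffect (blockRegisters_injective e) hE,
    Complex.ofReal_re]

/-- The registers of the private coins in `m` public coins. -/
def coinRegisters {m κ q : ℕ} {W : Type} (e : Fin (m * (κ * q)) ↪ W) : Fin m × Fin κ → Fin q → W :=
  fun p b => e (finProdFinEquiv (p.1, finProdFinEquiv (p.2, b)))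

lemma coinRegisters_injective {m κ q : ℕ} {W : Type} (e : Fin (m * (κ * q)) ↪ W) :
    Function.Injective fun p : (Fin m × Fin κ) × Fin q => coinRegisters e p.1 p.2 := by
  rintro ⟨⟨i, r⟩, b⟩ ⟨⟨i', r'⟩, b'⟩ h
  have := finProdFinEquiv.injective (e.injective h)
  simp only [Prod.mk.injEq, EmbeddingLike.apply_eq_iff_eq] at this
  simp [this]

/-! ### Exchangeable distributions of bits -/

/-- The number of accepted registers. -/
def hits {ι : Type} [Fintype ι] (O : ι → Bool) : ℕ :=
  (Finset.univ.filter fun i => O i = true).card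

section hits

variable {ι : Type} [Fintype ι]

lemma hits_comp_equiv {κ : Type} [Fintype κ] (θ : κ ≃ ι) (O : ι → Bool) :
    hits (fun k => O (θ k)) = hits O := by
  unfold hits
  exact Finset.card_equiv θ (by simp)

lemma hits_le_card (O : ι → Bool) : hits O ≤ Fintype.card ι := Finset.card_le_univ _

lemma hits_prod {α β : Type} [Fintype α] [Fintype β] (O : α × β → Bool) :
    hits O = ∑ a, hits fun b => O (a, b) := by
  simp only [hits, Finset.card_filter, Fintype.sum_prod_type]

/-- If the distribution of `card ι` bits is exchangeable, then the probability that at most `T` of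
them, among them all bits in `A`, are `1`, is at most `(T / card ι) ^ card A` times the probability
that at most `T` of them are `1`. -/
lemma sum_allTrue_le [DecidableEq ι] {p : (ι → Bool) → ℝ} (hp0 : ∀ O, 0 ≤ p O)
    (hp : ∀ (σ : Equiv.Perm ι) O, p (fun i => O (σ i)) = p O) {T : ℕ} (hT : T ≤ Fintype.card ι)
    (A : Finset ι) :
    ∑ O with hits O ≤ T ∧ ∀ i ∈ A, O i = true, p O ≤
      ((T : ℝ) / Fintype.card ι) ^ A.card * ∑ O with hits O ≤ T, p O := by
  induction A using Finset.induction_on with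
  | empty => simp
  | insert a A ha ih =>
    set G : Finset (ι → Bool) := Finset.univ.filter fun O => hits O ≤ T ∧ ∀ i ∈ A, O i = true
      with hG
    set f : ι → ℝ := fun i => ∑ O ∈ G, if O i = true then p O else 0 with hf
    have hfa : ∑ O with hits O ≤ T ∧ ∀ i ∈ insert a A, O i = true, p O = f a := by
      simp only [hf, hG, ← Finset.sum_filter, Finset.filter_filter]
      refine Finset.sum_congr (Finset.filter_congr fun O _ => ?_) fun _ _ => rfl
      simp only [Finset.forall_mem_insert]
      tauto
    -- Transposing `a` and `i` fixes `A` pointwise and preserves the number of hits, so by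
    -- exchangeability all positions outside `A` are equally likely to be `1`.
    have hswap : ∀ i ∈ Aᶜ, f i = f a := by
      intro i hi
      rw [Finset.mem_compl] at hi
      refine Finset.sum_equiv ((Equiv.swap a i).arrowCongr (Equiv.refl Bool)) (fun O => ?_) ?_
      · have h1 : hits (((Equiv.swap a i).arrowCongr (Equiv.refl Bool)) O) = hits O :=
          hits_comp_equiv (Equiv.swap a i).symm O
        have h2 : ∀ j ∈ A, ((Equiv.swap a i).arrowCongr (Equiv.refl Bool)) O j = O j := by
          intro j hj
          have : (Equiv.swap a i).symm j = j := by
            rw [Equiv.symm_swap]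
            exact Equiv.swap_apply_of_ne_of_ne (fun h => ha (h ▸ hj)) fun h => hi (h ▸ hj)
          exact congrArg O this
        simp only [hG, Finset.mem_filter, Finset.mem_univ, true_and, h1]
        exact and_congr_right fun _ => forall₂_congr fun j hj => by rw [h2 j hj]
      · intro O _
        have h1 : p (((Equiv.swap a i).arrowCongr (Equiv.refl Bool)) O) = p O :=
          hp (Equiv.swap a i).symm O
        rw [h1]
        simp [Equiv.arrowCongr]
    -- Double counting: the left side sums `f i` over all `i ∉ A`, and an `O` in `G` has `hits O -
    -- A.card ≤ T - A.card` ones outside `A`.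
    have hsum : ((Fintype.card ι : ℝ) - A.card) * f a ≤ ((T : ℝ) - A.card) * ∑ O ∈ G, p O := by
      have hc : ((Fintype.card ι : ℝ) - A.card) = (Aᶜ.card : ℝ) := by
        rw [Finset.card_compl, Nat.cast_sub (Finset.card_le_univ A)]
      rw [hc, ← nsmul_eq_mul, ← Finset.sum_const, ← Finset.sum_congr rfl hswap, Finset.sum_comm,
        Finset.mul_sum]
      refine Finset.sum_le_sum fun O hO => ?_
      simp only [hG, Finset.mem_filter, Finset.mem_univ, true_and] at hO
      rw [← Finset.sum_filter, Finset.sum_const, nsmul_eq_mul]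
      refine mul_le_mul_of_nonneg_right ?_ (hp0 O)
      have hcard : (Aᶜ.filter fun i => O i = true).card + A.card = hits O := by
        rw [hits, ← Finset.card_union_of_disjoint]
        · congr 1
          ext i
          simp only [Finset.mem_union, Finset.mem_filter, Finset.mem_compl, Finset.mem_univ,
            true_and]
          have := hO.2 i
          tauto
        · exact Finset.disjoint_left.2 fun i hi => Finset.mem_compl.1 (Finset.mem_filter.1 hi).1
      have : ((Aᶜ.filter fun i => O i = true).card : ℝ) + A.card ≤ T := by
        exact_mod_cast hcard ▸ hO.1
      linarith
    have hG0 : 0 ≤ ∑ O ∈ G, p O := Finset.sum_nonneg fun O _ => hp0 O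
    have hlt : (A.card : ℝ) < Fintype.card ι := by
      exact_mod_cast Finset.card_lt_univ_of_notMem ha
    have hN : (0 : ℝ) < Fintype.card ι := lt_of_le_of_lt (Nat.cast_nonneg _) hlt
    have hTN : (T : ℝ) ≤ Fintype.card ι := by exact_mod_cast hT
    -- Since `T ≤ card ι`, the ratio `(T - A.card) / (card ι - A.card)` is at most `T / card ι`.
    have hstep : f a ≤ (T : ℝ) / Fintype.card ι * ∑ O ∈ G, p O := by
      refine le_of_mul_le_mul_left (hsum.trans ?_) (sub_pos.2 hlt)
      rw [← mul_assoc]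
      refine mul_le_mul_of_nonneg_right ?_ hG0
      have hA : (0 : ℝ) ≤ A.card := Nat.cast_nonneg _
      rw [mul_div_assoc', le_div_iff₀ hN]
      nlinarith
    rw [hfa, Finset.card_insert_of_notMem ha, pow_succ', mul_assoc]
    exact hstep.trans (mul_le_mul_of_nonneg_left ih (by positivity))

end hits

/-! ### States in the symmetric subspace -/

section symmetric

variable {ι V : Type} {q : ℕ} {reg : ι → Fin q → V}

/-- The permutation of the qubits that permutes the registers. -/
def permuteRegisters (hreg : Function.Injective fun p : ι × Fin q => reg p.1 p.2)
    (σ : Equiv.Perm ι) : Equiv.Perm V :=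
  Equiv.Perm.viaEmbedding (σ.prodCongr (Equiv.refl (Fin q))) ⟨_, hreg⟩

lemma permuteRegisters_apply (hreg : Function.Injective fun p : ι × Fin q => reg p.1 p.2)
    (σ : Equiv.Perm ι) (i : ι) (b : Fin q) :
    permuteRegisters hreg σ (reg i b) = reg (σ i) b :=
  Equiv.Perm.viaEmbedding_apply _ ⟨_, hreg⟩ (i, b)

lemma permuteRegisters_of_ne (hreg : Function.Injective fun p : ι × Fin q => reg p.1 p.2)
    (σ : Equiv.Perm ι) {v : V} (hv : ∀ i b, reg i b ≠ v) : permuteRegisters hreg σ v = v :=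
  Equiv.Perm.viaEmbedding_apply_of_notMem _ ⟨_, hreg⟩ v fun ⟨p, hp⟩ => hv p.1 p.2 hp

variable [Fintype V]

lemma mem_symmetricSubspace_univ (hreg : Function.Injective fun p : ι × Fin q => reg p.1 p.2)
    {ψ : State V} : ψ ∈ symmetricSubspace reg Set.univ ↔
      ∀ (σ : Equiv.Perm ι) (x : V → Bool), ψ (fun v => x (permuteRegisters hreg σ v)) = ψ x := by
  constructor
  · intro h σ x
    refine h σ (by simp) x _ (fun i b => ?_) fun v hv => ?_
    · simp only [permuteRegisters_apply]
    · simp only [permuteRegisters_of_ne hreg σ hv]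
  · intro h σ _ x y h₁ h₂
    rw [← h σ x]
    refine congrArg ψ.ofLp (funext fun v => ?_)
    by_cases hv : ∀ i b, reg i b ≠ v
    · rw [h₂ v hv, permuteRegisters_of_ne hreg σ hv]
    · push Not at hv
      obtain ⟨i, b, rfl⟩ := hv
      rw [h₁, permuteRegisters_apply]

variable [Fintype ι] [DecidableEq V]

lemma registerOp_permute (hreg : Function.Injective fun p : ι × Fin q => reg p.1 p.2)
    (F : ι → Op (Fin q)) (σ : Equiv.Perm ι) (x y : V → Bool) :
    registerOp reg F (fun v => x (permuteRegisters hreg σ v))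
        (fun v => y (permuteRegisters hreg σ v)) =
      registerOp reg (fun i => F (σ.symm i)) x y := by
  have hoff : (∀ v, (∀ i b, reg i b ≠ v) →
      x (permuteRegisters hreg σ v) = y (permuteRegisters hreg σ v)) ↔
      ∀ v, (∀ i b, reg i b ≠ v) → x v = y v :=
    forall₂_congr fun v hv => by rw [permuteRegisters_of_ne hreg σ hv]
  unfold registerOp
  by_cases h : ∀ v, (∀ i b, reg i b ≠ v) → x v = y v
  · rw [if_pos (hoff.2 h), if_pos h]
    refine Fintype.prod_equiv σ _ _ fun i => ?_
    simp only [Equiv.symm_apply_apply, Function.comp_def, permuteRegisters_apply]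
  · rw [if_neg (mt hoff.1 h), if_neg h]

lemma applyOp_registersEffect_permute
    (hreg : Function.Injective fun p : ι × Fin q => reg p.1 p.2) (E : Op (Fin q)) {w : State V}
    (hw : w ∈ symmetricSubspace reg Set.univ) (O : ι → Bool) (σ : Equiv.Perm ι) (x : V → Bool) :
    applyOp (registersEffect reg E O) w (fun v => x (permuteRegisters hreg σ v)) =
      applyOp (registersEffect reg E fun i => O (σ.symm i)) w x := by
  rw [mem_symmetricSubspace_univ hreg] at hw
  rw [applyOp_apply, applyOp_apply]
  refine (Fintype.sum_equiv ((permuteRegisters hreg σ).symm.arrowCongr (Equiv.refl Bool)) _ _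
    fun y => ?_).symm
  have : (((permuteRegisters hreg σ).symm.arrowCongr (Equiv.refl Bool)) y) =
      fun v => y (permuteRegisters hreg σ v) := rfl
  rw [this, hw, registersEffect, registersEffect, registerOp_permute]

/-- Exchangeability: permuting the results only permutes the amplitudes of the projected state,
which leaves its norm unchanged. -/
lemma registersProb_permute (hreg : Function.Injective fun p : ι × Fin q => reg p.1 p.2)
    (E : Op (Fin q)) {w : State V} (hw : w ∈ symmetricSubspace reg Set.univ) (O : ι → Bool)
    (σ : Equiv.Perm ι) :
    registersProb reg E w (fun i => O (σ i)) = registersProb reg E w O := by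
  unfold registersProb
  rw [EuclideanSpace.norm_sq_eq, EuclideanSpace.norm_sq_eq]
  refine Fintype.sum_equiv ((permuteRegisters hreg σ.symm).symm.arrowCongr (Equiv.refl Bool)) _ _
    fun x => ?_
  have := applyOp_registersEffect_permute hreg E hw O σ.symm x
  rw [Equiv.symm_symm] at this
  rw [← this]
  rfl

/-- A register permutation merely reindexes the effects of single results, so the projector of a
permutation-invariant event commutes with all of them and preserves symmetry. This is what allows
`w` to be replaced by `v` in `⟨w, Q w⟩`. -/
lemma sum_registersEffect_mem_symmetricSubspace [DecidableEq ι]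
    (hreg : Function.Injective fun p : ι × Fin q => reg p.1 p.2) (E : Op (Fin q)) {w : State V}
    (hw : w ∈ symmetricSubspace reg Set.univ) {S : Finset (ι → Bool)}
    (hS : ∀ (σ : Equiv.Perm ι) O, O ∈ S → (fun i => O (σ i)) ∈ S) :
    ∑ O ∈ S, applyOp (registersEffect reg E O) w ∈ symmetricSubspace reg Set.univ := by
  rw [mem_symmetricSubspace_univ hreg]
  intro σ x
  simp only [WithLp.ofLp_sum, Finset.sum_apply, applyOp_registersEffect_permute hreg E hw]
  refine Finset.sum_equiv (σ.arrowCongr (Equiv.refl Bool)) (fun O => ⟨hS σ.symm O, fun h => ?_⟩)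
    fun O _ => rfl
  have := hS σ _ h
  simpa [Equiv.arrowCongr] using this

/-- If `w` is the projection of `v` onto the symmetric subspace, then verifying the registers after
the projection cannot be likelier to have results in a symmetric set than before, and if the results
`O` in the set that are possible for `v` are a fraction `r` of the results for symmetric states, then
it is less likely by the factor `r`. -/
lemma sum_registersProb_le [DecidableEq ι]
    (hreg : Function.Injective fun p : ι × Fin q => reg p.1 p.2) {E : Op (Fin q)}
    (hE : IsStarProjection E) {v w : State V} (hw : w ∈ symmetricSubspace reg Set.univ)
    (hvw : ∀ u ∈ symmetricSubspace reg Set.univ, inner ℂ v u = inner ℂ w u)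
    {S S' : Finset (ι → Bool)} (hS : ∀ (σ : Equiv.Perm ι) O, O ∈ S → (fun i => O (σ i)) ∈ S)
    (hS' : S' ⊆ S) (hv : ∀ O ∈ S, O ∉ S' → applyOp (registersEffect reg E O) v = 0) {r : ℝ}
    (hr0 : 0 ≤ r)
    (hr : ∑ O ∈ S', registersProb reg E w O ≤ r * ∑ O ∈ S, registersProb reg E w O) :
    ∑ O ∈ S, registersProb reg E w O ≤ r * ∑ O ∈ S, registersProb reg E v O := by
  set Q : (ι → Bool) → Op V := registersEffect reg E with hQ
  set a := ∑ O ∈ S, registersProb reg E w O with ha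
  set b := ∑ O ∈ S, registersProb reg E v O with hb
  have ha0 : 0 ≤ a := Finset.sum_nonneg fun O _ => registersProb_nonneg _ _ _ _
  have hb0 : 0 ≤ b := Finset.sum_nonneg fun O _ => registersProb_nonneg _ _ _ _
  -- The unprojected `v` replaces `w` on the left because the right argument is symmetric; then the
  -- results outside `S'` drop out, having no amplitude in `v`.
  have h1 : (a : ℂ) = ∑ O ∈ S', inner ℂ (applyOp (Q O) v) (applyOp (Q O) w) := by
    calc (a : ℂ) = inner ℂ w (∑ O ∈ S, applyOp (Q O) w) := by
          rw [inner_sum, ha, Complex.ofReal_sum]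
          exact Finset.sum_congr rfl fun O _ => (inner_registersEffect hreg hE w O).symm
      _ = inner ℂ v (∑ O ∈ S, applyOp (Q O) w) :=
          (hvw _ (sum_registersEffect_mem_symmetricSubspace hreg E hw hS)).symm
      _ = ∑ O ∈ S, inner ℂ (applyOp (Q O) v) (applyOp (Q O) w) := by
          rw [inner_sum]
          exact Finset.sum_congr rfl fun O _ => inner_applyOp_of_isStarProjection
            (registersEffect_isStarProjection hreg hE O) v w
      _ = _ := by
          refine (Finset.sum_subset hS' fun O hO hO' => ?_).symm
          rw [hv O hO hO', inner_zero_left]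
  have h2 : a ≤ ∑ O ∈ S', ‖applyOp (Q O) v‖ * ‖applyOp (Q O) w‖ := by
    calc a = ‖(a : ℂ)‖ := by rw [Complex.norm_real, Real.norm_of_nonneg ha0]
      _ ≤ _ := by
        rw [h1]
        exact norm_sum_le_of_le _ fun O _ => norm_inner_le_norm _ _
  -- Cauchy–Schwarz over the results in `S'`, with `hr` bounding the factor that belongs to `w`.
  -- Cancelling one factor `a` afterwards gives the claim.
  have h3 : a ^ 2 ≤ b * (r * a) := by
    calc a ^ 2 ≤ (∑ O ∈ S', ‖applyOp (Q O) v‖ * ‖applyOp (Q O) w‖) ^ 2 :=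
          pow_le_pow_left₀ ha0 h2 2
      _ ≤ (∑ O ∈ S', ‖applyOp (Q O) v‖ ^ 2) * ∑ O ∈ S', ‖applyOp (Q O) w‖ ^ 2 :=
          Finset.sum_mul_sq_le_sq_mul_sq _ _ _
      _ ≤ b * (r * a) := by
          refine mul_le_mul ?_ hr (Finset.sum_nonneg fun O _ => sq_nonneg _) hb0
          exact Finset.sum_le_sum_of_subset_of_nonneg hS' fun O _ _ => sq_nonneg _
  rcases ha0.eq_or_lt with h0 | h0
  · rw [← h0]; positivity
  · nlinarith

/-- The probability of projecting onto the symmetric subspace a state whose registers in `A` are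
accepted with certainty. -/
lemma norm_sq_symmetric_le [DecidableEq ι]
    (hreg : Function.Injective fun p : ι × Fin q => reg p.1 p.2) {E : Op (Fin q)}
    (hE : IsStarProjection E) {v w : State V} (hw : w ∈ symmetricSubspace reg Set.univ)
    (hvw : ∀ u ∈ symmetricSubspace reg Set.univ, inner ℂ v u = inner ℂ w u) (A : Finset ι)
    (hv : ∀ O : ι → Bool, (∃ i ∈ A, O i = false) → applyOp (registersEffect reg E O) v = 0)
    {T : ℕ} (hT : T ≤ Fintype.card ι) :
    ‖w‖ ^ 2 ≤ ∑ O, (if hits O ≤ T then ((T : ℝ) / Fintype.card ι) ^ A.card else 1) *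
      registersProb reg E v O := by
  have hgood : ∑ O with hits O ≤ T, registersProb reg E w O ≤
      ((T : ℝ) / Fintype.card ι) ^ A.card * ∑ O with hits O ≤ T, registersProb reg E v O := by
    refine sum_registersProb_le (S' := Finset.univ.filter fun O =>
      hits O ≤ T ∧ ∀ i ∈ A, O i = true) hreg hE hw hvw ?_ ?_ ?_ (by positivity) ?_
    · intro σ O hO
      simpa [hits_comp_equiv σ O] using hO
    · intro O hO
      simp only [Finset.mem_filter, Finset.mem_univ, true_and] at hO ⊢
      exact hO.1
    · intro O hO hO'
      simp only [Finset.mem_filter, Finset.mem_univ, true_and] at hO hO'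
      refine hv O ?_
      by_contra h
      push Not at h
      exact hO' ⟨hO, fun i hi => by simpa using h i hi⟩
    · exact sum_allTrue_le (p := registersProb reg E w) (fun O => registersProb_nonneg _ _ _ _)
        (fun σ O => registersProb_permute hreg E hw O σ) hT A
  -- With many hits nothing is known about the positions in `A`; the trivial choice `S' = S`, `r =
  -- 1` shows that the projection at least does not increase the weight of a symmetric event.
  have hbad : ∑ O with ¬ hits O ≤ T, registersProb reg E w O ≤
      1 * ∑ O with ¬ hits O ≤ T, registersProb reg E v O := by
    refine sum_registersProb_le hreg hE hw hvw ?_ subset_rfl (fun O h h' => absurd h h')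
      zero_le_one (by rw [one_mul])
    intro σ O hO
    simpa [hits_comp_equiv σ O] using hO
  rw [← sum_registersProb hreg hE w, ← Finset.sum_filter_add_sum_filter_not _ fun O => hits O ≤ T]
  refine (add_le_add hgood hbad).trans_eq ?_
  rw [Finset.mul_sum, Finset.mul_sum, Finset.sum_filter, Finset.sum_filter,
    ← Finset.sum_add_distrib]
  refine Finset.sum_congr rfl fun O _ => ?_
  split_ifs <;> simp_all

end symmetric

/-! ### Product states -/

lemma coins_apply {s ℓ k : ℕ} (hs : 0 < s) (h : ℓ = k * s) (φ : State (Fin s))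
    (x : Fin ℓ → Bool) :
    coins φ ℓ x = ∏ i : Fin k, φ fun b => x (Fin.cast h.symm (finProdFinEquiv (i, b))) := by
  subst h
  have hc : ∀ i : Fin (k * s), k * s / s * s ≤ i → x i = false := by
    intro i hi
    rw [Nat.mul_div_cancel k hs] at hi
    exact absurd i.2 (not_lt.2 hi)
  change (if ∀ i : Fin (k * s), k * s / s * s ≤ i → x i = false then
      ∏ i : Fin (k * s / s), φ (block (x ∘ blocksEmb (k * s) s) i) else 0) = _
  rw [if_pos hc]
  refine Fintype.prod_equiv (finCongr (Nat.mul_div_cancel k hs)) _ _ fun i => ?_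
  refine congrArg φ.ofLp (funext fun b => congrArg x (Fin.ext ?_))
  simp [blocksEmb]

lemma coins_mul_apply {s k : ℕ} (hs : 0 < s) (φ : State (Fin s)) (x : Fin (k * s) → Bool) :
    coins φ (k * s) x = ∏ i : Fin k, φ (block x i) :=
  coins_apply hs rfl φ x

/-- Mint calls agree in the two games: blocks of public coins hold the same state as blocks of
private coins. Divisibility excludes leftover qubits on both sides. -/
lemma coins_coins {q κ ℓ : ℕ} (hq : 0 < q) (hκ : 0 < κ) (h : κ * q ∣ ℓ) (φ : State (Fin q)) :
    coins (coins φ (κ * q)) ℓ = coins φ ℓ := by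
  obtain ⟨t, rfl⟩ := h
  have h1 : κ * q * t = t * (κ * q) := mul_comm _ _
  have h2 : κ * q * t = (t * κ) * q := by ring
  ext x
  rw [coins_apply (mul_pos hκ hq) h1, coins_apply hq h2,
    ← finProdFinEquiv.prod_comp, Fintype.prod_prod_type]
  refine Finset.prod_congr rfl fun i _ => ?_
  rw [coins_mul_apply hq]
  refine Finset.prod_congr rfl fun r _ => ?_
  refine congrArg φ.ofLp (funext fun b => congrArg x (Fin.ext ?_))
  simp [finProdFinEquiv]
  ring

/-- The decomposition of the content of `m` consecutive blocks. -/
def blockEquiv (m s : ℕ) : (Fin (m * s) → Bool) ≃ (Fin m → Fin s → Bool) :=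
  (finProdFinEquiv.symm.arrowCongr (Equiv.refl Bool)).trans (Equiv.curry _ _ _)

lemma blockEquiv_apply {m s : ℕ} (x : Fin (m * s) → Bool) (i : Fin m) :
    blockEquiv m s x i = block x i := rfl

lemma norm_coins {s k : ℕ} (hs : 0 < s) {φ : State (Fin s)} (hφ : ‖φ‖ = 1) :
    ‖coins φ (k * s)‖ = 1 := by
  have h : ‖coins φ (k * s)‖ ^ 2 = 1 := by
    rw [EuclideanSpace.norm_sq_eq]
    simp only [coins_mul_apply hs, norm_prod, ← Finset.prod_pow, ← blockEquiv_apply]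
    have := Finset.prod_univ_sum (fun _ : Fin k => Finset.univ)
      fun _ (y : Fin s → Bool) => ‖φ y‖ ^ 2
    rw [Fintype.piFinset_univ] at this
    rw [(blockEquiv k s).sum_comp fun y : Fin k → Fin s → Bool => ∏ i, ‖φ (y i)‖ ^ 2, ← this]
    simp [← EuclideanSpace.norm_sq_eq, hφ]
  exact (pow_eq_one_iff_of_nonneg (norm_nonneg _) two_ne_zero).1 h

lemma applyOp_tensorOp_coins {s k : ℕ} (hs : 0 < s) (φ : State (Fin s)) (F : Fin k → Op (Fin s))
    (x : Fin (k * s) → Bool) :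
    applyOp (tensorOp F) (coins φ (k * s)) x = ∏ i, applyOp (F i) φ (block x i) := by
  simp only [applyOp_apply, coins_mul_apply hs, tensorOp, ← Finset.prod_mul_distrib,
    Finset.prod_univ_sum, Fintype.piFinset_univ]
  exact (blockEquiv k s).sum_comp fun y : Fin k → Fin s → Bool =>
    ∏ i, F i (block x i) (y i) * φ (y i)

lemma norm_sq_tensorState {V W : Type} [Fintype V] [Fintype W] [DecidableEq V] [DecidableEq W]
    (φ : State V) (ψ : State W) :
    ‖tensorState φ ψ‖ ^ 2 = ‖φ‖ ^ 2 * ‖ψ‖ ^ 2 := by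
  simp only [EuclideanSpace.norm_sq_eq, Finset.sum_mul_sum, ← Fintype.sum_prod_type']
  refine Fintype.sum_equiv (Equiv.sumArrowEquivProdArrow V W Bool) _ _ fun x => ?_
  rw [← mul_pow, ← norm_mul]
  rfl

lemma norm_sq_append {N ℓ : ℕ} (ψ : State (Fin N)) (φ : State (Fin ℓ)) :
    ‖append ψ φ‖ ^ 2 = ‖ψ‖ ^ 2 * ‖φ‖ ^ 2 := by
  simp only [EuclideanSpace.norm_sq_eq, Finset.sum_mul_sum, ← Fintype.sum_prod_type']
  refine Fintype.sum_equiv (Fin.appendEquiv N ℓ).symm _ _ fun x => ?_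
  rw [← mul_pow, ← norm_mul]
  rfl

lemma norm_zeros (ℓ : ℕ) : ‖zeros ℓ‖ = 1 := by
  simp [zeros]

lemma norm_sq_measured_add {N : ℕ} (c : Fin N) (ψ : State (Fin N)) :
    ‖measured c true ψ‖ ^ 2 + ‖measured c false ψ‖ ^ 2 = ‖ψ‖ ^ 2 := by
  simp only [EuclideanSpace.norm_sq_eq, ← Finset.sum_add_distrib, measured]
  refine Finset.sum_congr rfl fun x _ => ?_
  cases x c <;> simp

/-! ### The private counts -/

lemma onWires_refl {k : ℕ} (A : Op (Fin k)) : onWires (Function.Embedding.refl (Fin k)) A = A := by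
  ext x y
  simp [onWires]
  rfl

lemma sum_resultsEffect {κ q : ℕ} (E : Op (Fin q)) :
    ∑ o : Fin κ → Bool, resultsEffect E o = 1 := by
  rw [← sum_registersEffect (reg := blockRegisters (Function.Embedding.refl (Fin (κ * q)))) E]
  refine Finset.sum_congr rfl fun o _ => ?_
  rw [← onWires_refl (resultsEffect E o)]
  exact onWires_tensorOp _ _

/-- The probability that the bank accepts, or rejects, a public coin, if `k` of the `κ` private
coins in it are accepted. -/
def bankWeight (κ k : ℕ) (b : Bool) : ℝ := if b = true then (k : ℝ) / κ else 1 - (k : ℝ) / κ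

lemma resultEffect_bankEffect {κ q : ℕ} (E : Op (Fin q)) (b : Bool) :
    resultEffect (bankEffect κ E) b =
      ∑ o : Fin κ → Bool, (bankWeight κ (count o) b : ℂ) • resultsEffect E o := by
  cases b
  · simp only [resultEffect, bankWeight, bankEffect, Bool.false_eq_true, if_false]
    rw [← sum_resultsEffect (κ := κ) E, ← Finset.sum_sub_distrib]
    refine Finset.sum_congr rfl fun o _ => ?_
    push_cast
    rw [sub_smul, one_smul]
  · simp [resultEffect, bankWeight, bankEffect]

/-- Each bank effect is a mixture of the private result projectors of one public coin; multiplying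
out over the coins gives a mixture of joint results of all private coins. -/
lemma onWires_bankEffect {κ q m : ℕ} {W : Type} (E : Op (Fin q)) (e : Fin (m * (κ * q)) ↪ W)
    (o : Fin m → Bool) :
    onWires e (resultsEffect (bankEffect κ E) o) =
      ∑ O : Fin m → Fin κ → Bool, ((∏ i, bankWeight κ (count (O i)) (o i) : ℝ) : ℂ) •
        registersEffect (coinRegisters e) E fun p => O p.1 p.2 := by
  classical
  have h : resultsEffect (bankEffect κ E) o =
      tensorOp fun i => ∑ o', (bankWeight κ (count o') (o i) : ℂ) • resultsEffect E o' := by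
    unfold resultsEffect
    congr 1
    exact funext fun i => resultEffect_bankEffect E (o i)
  rw [h, onWires_tensorOp, registerOp_sum]
  refine Finset.sum_congr rfl fun O _ => ?_
  ext x y
  have hoff : (∀ v, (∀ i b, e (finProdFinEquiv (i, b)) ≠ v) → x v = y v) ↔
      ∀ v, (∀ p b, coinRegisters e p b ≠ v) → x v = y v := by
    refine forall_congr' fun v => imp_congr_left ?_
    refine ⟨fun h p b => h p.1 _, fun h i b => ?_⟩
    have := h (i, (finProdFinEquiv.symm b).1) (finProdFinEquiv.symm b).2
    rwa [coinRegisters, Prod.mk.eta, Equiv.apply_symm_apply] at this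
  rw [Matrix.smul_apply]
  unfold registersEffect registerOp
  by_cases hx : ∀ v, (∀ i b, e (finProdFinEquiv (i, b)) ≠ v) → x v = y v
  · rw [if_pos hx, if_pos (hoff.1 hx), Fintype.prod_prod_type, Complex.ofReal_prod, smul_eq_mul,
      ← Finset.prod_mul_distrib]
    rfl
  · rw [if_neg hx, if_neg (mt hoff.2 hx), smul_zero]

/-- The bank count is thus the private verification of all registers, followed by independent
classical coin tosses with biases `k / κ`. -/
lemma verificationOf_bankEffect {κ q N m : ℕ} {E : Op (Fin q)} (hE : IsStarProjection E)
    (e : Fin (m * (κ * q)) ↪ Fin N) (ψ : State (Fin N)) (o : Fin m → Bool) :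
    verificationOf (bankEffect κ E) e ψ o =
      ∑ O : Fin m × Fin κ → Bool, (∏ i, bankWeight κ (hits fun r => O (i, r)) (o i)) *
        registersProb (coinRegisters e) E ψ O := by
  rw [verificationOf, onWires_bankEffect, applyOp_sum, inner_sum, Complex.re_sum]
  refine Fintype.sum_equiv (Equiv.curry _ _ _).symm _ _ fun O => ?_
  rw [applyOp_smul, inner_smul_right, inner_registersEffect (coinRegisters_injective e) hE,
    ← Complex.ofReal_mul, Complex.ofReal_re]
  rfl

lemma sum_prod_bernoulli {m : ℕ} (p : Fin m → ℝ) :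
    ∑ o : Fin m → Bool, ∏ i, (if o i = true then p i else 1 - p i) = 1 := by
  have := Finset.prod_univ_sum (fun _ : Fin m => (Finset.univ : Finset Bool))
    fun i b => if b = true then p i else 1 - p i
  rw [Fintype.piFinset_univ] at this
  rw [← this]
  simp

/-- Linearity of expectation for independent coin tosses. -/
lemma sum_prod_bernoulli_mul_count {m : ℕ} (p : Fin m → ℝ) :
    ∑ o : Fin m → Bool, (∏ i, (if o i = true then p i else 1 - p i)) * (count o : ℝ) =
      ∑ i, p i := by
  have hc : ∀ o : Fin m → Bool, (count o : ℝ) = ∑ j, if o j = true then 1 else 0 := by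
    intro o
    simp [count]
  simp only [hc, Finset.mul_sum]
  rw [Finset.sum_comm]
  refine Finset.sum_congr rfl fun j _ => ?_
  -- The indicator of `o j = true` is written as a product over `i` with trivial factors for `i ≠
  -- j`, so that the sum over `o` still factorises.
  have h := Finset.prod_univ_sum (fun _ : Fin m => (Finset.univ : Finset Bool))
    fun i b => (if b = true then p i else 1 - p i) *
      (if i = j then (if b = true then 1 else 0) else 1)
  rw [Fintype.piFinset_univ] at h
  simp only [Finset.prod_mul_distrib, Finset.prod_ite_eq', Finset.mem_univ, if_true] at h
  rw [← h]
  have : ∀ i, ∑ b : Bool, ((if b = true then p i else 1 - p i) *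
      (if i = j then (if b = true then 1 else 0) else 1)) = if i = j then p j else 1 := by
    intro i
    split_ifs with hij <;> simp [hij]
  simp only [this, Finset.prod_ite_eq', Finset.mem_univ, if_true]

lemma hits_le_mul {m κ : ℕ} (O : Fin m × Fin κ → Bool) : hits O ≤ m * κ := by
  simpa using hits_le_card O

/-- The expected gain from a bank count. -/
lemma sum_bank_le {κ q N m : ℕ} (hκ : 0 < κ) {E : Op (Fin q)} (hE : IsStarProjection E)
    (e : Fin (m * (κ * q)) ↪ Fin N) (ψ : State (Fin N)) (n : ℕ) :
    ∑ o, verificationOf (bankEffect κ E) e ψ o * allOrNothingUtility ⟨0, count o, n, False⟩ ≤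
      m * ∑ O, registersProb (coinRegisters e) E ψ O * if κ * n < hits O then 1 else 0 := by
  have hκ' : (0 : ℝ) < κ := by exact_mod_cast hκ
  simp only [verificationOf_bankEffect hE, allOrNothingUtility, if_false, Finset.sum_mul]
  rw [Finset.sum_comm, Finset.mul_sum]
  refine Finset.sum_le_sum fun O _ => ?_
  -- Given the private results `O`, the expected number of accepted public coins is `hits O / κ`.
  have h1 : ∑ o : Fin m → Bool, (∏ i, bankWeight κ (hits fun r => O (i, r)) (o i)) *
      registersProb (coinRegisters e) E ψ O * (((0 : ℕ) : ℝ) + (count o : ℝ) - n) =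
      registersProb (coinRegisters e) E ψ O * ((hits O : ℝ) / κ - n) := by
    have ha := sum_prod_bernoulli fun i : Fin m => ((hits fun r => O (i, r) : ℕ) : ℝ) / κ
    have hb := sum_prod_bernoulli_mul_count
      fun i : Fin m => ((hits fun r => O (i, r) : ℕ) : ℝ) / κ
    rw [← Finset.sum_div, ← Nat.cast_sum, ← hits_prod] at hb
    calc _ = ∑ o : Fin m → Bool, registersProb (coinRegisters e) E ψ O *
          ((∏ i, bankWeight κ (hits fun r => O (i, r)) (o i)) * (count o : ℝ) -
            (∏ i, bankWeight κ (hits fun r => O (i, r)) (o i)) * n) := by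
          refine Finset.sum_congr rfl fun o _ => ?_
          push_cast
          ring
      _ = _ := by
          rw [← Finset.mul_sum, Finset.sum_sub_distrib, ← Finset.sum_mul]
          unfold bankWeight
          rw [ha, hb, one_mul]
  rw [h1, mul_left_comm]
  refine mul_le_mul_of_nonneg_left ?_ (registersProb_nonneg _ _ _ _)
  have h2 : (hits O : ℝ) ≤ m * κ := by exact_mod_cast hits_le_mul O
  have hn : (0 : ℝ) ≤ n := Nat.cast_nonneg _
  split_ifs with h
  · have : (hits O : ℝ) / κ ≤ m := by rwa [div_le_iff₀ hκ']
    linarith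
  · have h3 : (hits O : ℝ) ≤ κ * n := by exact_mod_cast not_lt.1 h
    have : (hits O : ℝ) / κ ≤ n := by rwa [div_le_iff₀ hκ', mul_comm]
    linarith

/-- Counting the private coins in public coins. -/
lemma sum_verificationOf {κ q N ℓ : ℕ} (hκ : 0 < κ) (hq : 0 < q) (hℓ : κ * q ∣ ℓ) {E : Op (Fin q)}
    (hE : IsStarProjection E) (ws : Fin ℓ ↪ Fin N) (ψ : State (Fin N)) (g : ℕ → ℝ) :
    ∑ o, verificationOf E ((blocksEmb ℓ q).trans ws) ψ o * g (count o) =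
      ∑ O, registersProb (coinRegisters ((blocksEmb ℓ (κ * q)).trans ws)) E ψ O * g (hits O) := by
  have h : ℓ / (κ * q) * κ = ℓ / q := by
    obtain ⟨t, rfl⟩ := hℓ
    rw [Nat.mul_div_cancel_left _ (mul_pos hκ hq), mul_comm κ q, mul_assoc,
      Nat.mul_div_cancel_left _ hq, mul_comm]
  -- Lexicographic numbering: register `r` of public coin `i` is private coin number `r + κ * i`,
  -- and occupies the same qubits.
  let θ : Fin (ℓ / (κ * q)) × Fin κ ≃ Fin (ℓ / q) := finProdFinEquiv.trans (finCongr h)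
  have hreg : (fun p => blockRegisters ((blocksEmb ℓ q).trans ws) (θ p)) =
      coinRegisters ((blocksEmb ℓ (κ * q)).trans ws) := by
    funext p b
    refine congrArg ws (Fin.ext ?_)
    simp [blocksEmb, θ, finProdFinEquiv]
    ring
  refine Fintype.sum_equiv (θ.symm.arrowCongr (Equiv.refl Bool)) _ _ fun o => ?_
  have ho : (θ.symm.arrowCongr (Equiv.refl Bool)) o = fun p => o (θ p) := rfl
  rw [ho, hits_comp_equiv, verificationOf_eq hE, ← hreg, registersProb_comp_equiv]
  rfl

/-! ### Sequences of projective measurements -/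

/-- Conditioning on the first measurement. Only the Pythagorean splitting at each step matters, so
the probabilities add up without any commutation between the tests. -/
lemma sum_norm_sq_foldl {H : Type*} [NormedAddCommGroup H] {m : ℕ} (S : Fin m → H → H)
    (hS : ∀ i χ, ‖S i χ‖ ^ 2 + ‖χ - S i χ‖ ^ 2 = ‖χ‖ ^ 2) (v : H) :
    ∑ o : Fin m → Bool, ‖(List.finRange m).foldl
      (fun χ i => if o i = true then S i χ else χ - S i χ) v‖ ^ 2 = ‖v‖ ^ 2 := by
  induction m generalizing v with
  | zero => simp
  | succ m ih =>
    rw [← (Fin.consEquiv fun _ => Bool).sum_comp, Fintype.sum_prod_type]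
    simp only [List.finRange_succ, List.foldl_cons, List.foldl_map, Fin.consEquiv_apply,
      Fin.cons_zero, Fin.cons_succ]
    simp only [ih (fun i => S i.succ) (fun i => hS i.succ)]
    simp [hS]

lemma norm_sq_starProjection_add {H : Type*} [NormedAddCommGroup H] [InnerProductSpace ℂ H]
    (K : Submodule ℂ H) [K.HasOrthogonalProjection] (χ : H) :
    ‖K.starProjection χ‖ ^ 2 + ‖χ - K.starProjection χ‖ ^ 2 = ‖χ‖ ^ 2 := by
  have h : inner ℂ (K.starProjection χ) (χ - K.starProjection χ) = 0 :=
    Submodule.inner_right_of_mem_orthogonal (K.starProjection_apply_mem χ)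
      (K.sub_starProjection_mem_orthogonal χ)
  have := norm_add_sq_eq_norm_sq_add_norm_sq_of_inner_eq_zero _ _ h
  rw [add_sub_cancel] at this
  rw [sq, sq, sq, this]

lemma symmetricSubspace_mono {ι V : Type} [Fintype V] {q : ℕ} (reg : ι → Fin q → V)
    {R R' : Set ι} (h : R ⊆ R') : symmetricSubspace reg R' ≤ symmetricSubspace reg R :=
  fun _ hψ σ hσ => hψ σ fun i hi => hσ i fun hi' => hi (h hi')

/-! ### The public count: symmetric projections of the wallet and the alleged coins -/

section publicVerification

variable {κ q N m : ℕ}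

/-- Each projection is self-adjoint and fixes `u`, since a vector symmetric in all registers is
symmetric in fewer. Together with `foldl_symmetricProjection_mem`, this identifies the accepted
branch as the orthogonal projection of `v` onto the full symmetric subspace. -/
lemma inner_foldl_symmetricProjection (e : Fin (m * (κ * q)) ↪ Fin N) (l : List (Fin m))
    (v : State (Fin (κ * q) ⊕ Fin N)) {u : State (Fin (κ * q) ⊕ Fin N)}
    (hu : u ∈ symmetricSubspace (registers e) Set.univ) :
    inner ℂ v u = inner ℂ (l.foldl (fun χ i => symmetricProjection e i χ) v) u := by
  induction l generalizing v with
  | nil => rfl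
  | cons i l ih =>
    rw [List.foldl_cons, ← ih, symmetricProjection,
      Submodule.inner_starProjection_left_eq_right,
      Submodule.starProjection_eq_self_iff.2
        (symmetricSubspace_mono (registers e) (Set.subset_univ _) hu)]

/-- The last test involves every register. For `m = 0` there is no test, whence the hypothesis. -/
lemma foldl_symmetricProjection_mem (e : Fin (m * (κ * q)) ↪ Fin N) (hm : 0 < m)
    (v : State (Fin (κ * q) ⊕ Fin N)) :
    (List.finRange m).foldl (fun χ i => symmetricProjection e i χ) v ∈
      symmetricSubspace (registers e) Set.univ := by
  obtain _ | m := m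
  · exact absurd hm (lt_irrefl 0)
  rw [List.finRange_succ_last, List.foldl_append, List.foldl_cons, List.foldl_nil]
  have h : {r : Option (Fin (m + 1)) × Fin κ | ∀ j, r.1 = some j → j ≤ Fin.last m} = Set.univ :=
    Set.eq_univ_of_forall fun r j _ => Fin.le_last j
  exact symmetricSubspace_mono _ h.ge (Submodule.starProjection_apply_mem _ _)

lemma registers_injective (e : Fin (m * (κ * q)) ↪ Fin N) :
    Function.Injective fun p : (Option (Fin m) × Fin κ) × Fin q => registers e p.1 p.2 := by
  rintro ⟨⟨_ | i, r⟩, b⟩ ⟨⟨_ | i', r'⟩, b'⟩ h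
  · have := finProdFinEquiv.injective (Sum.inl_injective h)
    simp only [Prod.mk.injEq] at this
    simp [this]
  · cases h
  · cases h
  · have := @coinRegisters_injective m κ q _ e ((i, r), b) ((i', r'), b') (Sum.inr_injective h)
    simp only [Prod.mk.injEq] at this
    simp [this]

lemma registersEffect_registers (e : Fin (m * (κ * q)) ↪ Fin N) (E : Op (Fin q))
    (O : Option (Fin m) × Fin κ → Bool) (x y : Fin (κ * q) ⊕ Fin N → Bool) :
    registersEffect (registers e) E O x y =
      tensorOp (fun r => resultEffect E (O (none, r))) (x ∘ Sum.inl) (y ∘ Sum.inl) *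
        registersEffect (coinRegisters e) E (fun p => O (some p.1, p.2)) (x ∘ Sum.inr)
          (y ∘ Sum.inr) := by
  have hoff : (∀ v, (∀ p b, registers e p b ≠ v) → x v = y v) ↔
      ∀ v, (∀ p b, coinRegisters e p b ≠ v) → (x ∘ Sum.inr) v = (y ∘ Sum.inr) v := by
    constructor
    · intro h v hv
      refine h (Sum.inr v) ?_
      rintro ⟨_ | i, r⟩ b h'
      · cases h'
      · exact hv (i, r) b (Sum.inr_injective h')
    · rintro h (v | v) hv
      · exact absurd (congrArg Sum.inl (finProdFinEquiv.apply_symm_apply v))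
          (hv (none, (finProdFinEquiv.symm v).1) (finProdFinEquiv.symm v).2)
      · exact h v fun p b h' => hv (some p.1, p.2) b (congrArg Sum.inr h')
  unfold registersEffect registerOp
  by_cases h : ∀ v, (∀ p b, registers e p b ≠ v) → x v = y v
  · rw [if_pos h, if_pos (hoff.1 h), Fintype.prod_prod_type, Fintype.prod_option,
      Fintype.prod_prod_type]
    rfl
  · rw [if_neg h, if_neg (mt hoff.2 h), mul_zero]

/-- Wallet and submitted coins are initially in a product state, so the result amplitudes factorise;
hence the wallet results can be split off. -/
lemma applyOp_registersEffect_tensorState (e : Fin (m * (κ * q)) ↪ Fin N) (E : Op (Fin q))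
    (O : Option (Fin m) × Fin κ → Bool) (φ : State (Fin (κ * q))) (ψ : State (Fin N)) :
    applyOp (registersEffect (registers e) E O) (tensorState φ ψ) =
      tensorState (applyOp (tensorOp fun r => resultEffect E (O (none, r))) φ)
        (applyOp (registersEffect (coinRegisters e) E fun p => O (some p.1, p.2)) ψ) := by
  ext x
  change _ = applyOp _ φ (x ∘ Sum.inl) * applyOp _ ψ (x ∘ Sum.inr)
  simp only [applyOp_apply, Finset.sum_mul_sum, ← Fintype.sum_prod_type']
  refine Fintype.sum_equiv (Equiv.sumArrowEquivProdArrow _ _ Bool) _ _ fun y => ?_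
  rw [registersEffect_registers, mul_mul_mul_comm]
  rfl

lemma applyOp_tensorOp_resultEffect_coins (hq : 0 < q) {E : Op (Fin q)} {φ : State (Fin q)}
    (hφE : applyOp E φ = φ) (o : Fin κ → Bool) :
    applyOp (tensorOp fun r => resultEffect E (o r)) (coins φ (κ * q)) =
      if ∃ r, o r = false then 0 else coins φ (κ * q) := by
  ext x
  rw [applyOp_tensorOp_coins hq]
  split_ifs with h
  · obtain ⟨r, hr⟩ := h
    refine Finset.prod_eq_zero (Finset.mem_univ r) ?_
    have : applyOp (resultEffect E (o r)) φ = 0 := by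
      have h1 : applyOp (1 - E) φ = applyOp 1 φ - applyOp E φ := by
        simp [applyOp, Matrix.sub_mulVec]
      rw [hr, resultEffect, if_neg Bool.false_ne_true, h1, applyOp_one, hφE, sub_self]
    rw [this]
    rfl
  · rw [coins_mul_apply hq]
    refine Finset.prod_congr rfl fun r _ => ?_
    have hr : o r = true := by
      by_contra h'
      exact h ⟨r, by simpa using h'⟩
    rw [hr, resultEffect, if_pos rfl, hφE]

/-- The results of the verification of alleged coins, and acceptance of the coin of the wallet. -/
def withWallet (O : Fin m × Fin κ → Bool) (p : Option (Fin m) × Fin κ) : Bool :=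
  p.1.elim true fun i => O (i, p.2)

lemma hits_withWallet (O : Fin m × Fin κ → Bool) : hits (withWallet O) = κ + hits O := by
  have h : (hits fun r : Fin κ => withWallet O (none, r)) = κ := by simp [withWallet, hits]
  rw [hits_prod, hits_prod, Fintype.sum_option, h]
  rfl

/-- The probability that all alleged coins pass the public verification. -/
lemma publicVerification_true_le (hq : 0 < q) {E : Op (Fin q)} (hE : IsStarProjection E)
    {φ : State (Fin q)} (hφ : ‖φ‖ = 1) (hφE : applyOp E φ = φ)
    (e : Fin (m * (κ * q)) ↪ Fin N) (ψ : State (Fin N)) {n : ℕ} (hn : n < m) :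
    publicVerification (coins φ (κ * q)) e ψ (fun _ => true) ≤
      ∑ O, (if hits O ≤ κ * n then
        ((((n + 1) * κ : ℕ) : ℝ) / ((m + 1) * κ : ℕ)) ^ κ else 1) *
          registersProb (coinRegisters e) E ψ O := by
  classical
  set v := tensorState (coins φ (κ * q)) ψ with hv
  set A : Finset (Option (Fin m) × Fin κ) := Finset.univ.image fun r => (none, r) with hA
  have hAcard : A.card = κ := by
    rw [hA, Finset.card_image_of_injective _ fun _ _ h => (Prod.mk.inj h).2]
    simp
  have hcard : Fintype.card (Option (Fin m) × Fin κ) = (m + 1) * κ := by simp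
  have hzero : ∀ O : Option (Fin m) × Fin κ → Bool, (∃ r, O (none, r) = false) →
      applyOp (registersEffect (registers e) E O) v = 0 := by
    intro O hO
    rw [applyOp_registersEffect_tensorState, applyOp_tensorOp_resultEffect_coins hq hφE,
      if_pos hO]
    ext x
    exact zero_mul _
  have hprob : ∀ O, registersProb (registers e) E v (withWallet O) =
      registersProb (coinRegisters e) E ψ O := by
    intro O
    have : ¬ ∃ r : Fin κ, withWallet O (none, r) = false := by simp [withWallet]
    rw [registersProb, applyOp_registersEffect_tensorState,
      applyOp_tensorOp_resultEffect_coins hq hφE, if_neg this, norm_sq_tensorState,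
      norm_coins hq hφ, one_pow, one_mul]
    rfl
  -- The threshold `(n + 1) * κ` is `κ * n` hits on the alleged coins plus the `κ` certain hits of
  -- the wallet registers `A`.
  have key := norm_sq_symmetric_le (registers_injective e) hE
    (foldl_symmetricProjection_mem e (Nat.zero_lt_of_lt hn) v)
    (fun u hu => inner_foldl_symmetricProjection e (List.finRange m) v hu) A
    (fun O ⟨i, hi, hO⟩ => by
      obtain ⟨r, _, rfl⟩ := Finset.mem_image.1 hi
      exact hzero O ⟨r, hO⟩) (T := (n + 1) * κ)
    (by rw [hcard]; exact Nat.mul_le_mul_right κ (by omega))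
  have hfold : publicVerification (coins φ (κ * q)) e ψ (fun _ => true) =
      ‖(List.finRange m).foldl (fun χ i => symmetricProjection e i χ) v‖ ^ 2 := by
    simp [publicVerification, hv]
  rw [hfold]
  refine key.trans_eq ?_
  rw [hAcard, hcard]
  -- Only results that accept the whole wallet have weight in `v`, and these are the extensions
  -- `withWallet O` of results on the alleged coins.
  refine (Finset.sum_of_injOn withWallet ?_ ?_ ?_ ?_).symm
  · intro O _ O' _ h
    funext p
    exact congrFun h (some p.1, p.2)
  · intro O _
    simp
  · intro O _ hO
    have : ∃ r, O (none, r) = false := by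
      by_contra h
      push Not at h
      refine hO ⟨fun p => O (some p.1, p.2), by simp, ?_⟩
      funext ⟨i, r⟩
      cases i with
      | none =>
        have hr : O (none, r) = true := by simpa using h r
        exact hr.symm
      | some i => rfl
    rw [registersProb, hzero O this]
    simp
  · intro O _
    have : hits (withWallet O) ≤ (n + 1) * κ ↔ hits O ≤ κ * n := by
      rw [hits_withWallet, add_mul, one_mul, mul_comm n κ, add_comm κ]
      exact Nat.add_le_add_iff_right
    simp only [hprob, this]

lemma sum_publicVerification (hq : 0 < q) {φ : State (Fin q)} (hφ : ‖φ‖ = 1)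
    (e : Fin (m * (κ * q)) ↪ Fin N) (ψ : State (Fin N)) :
    ∑ o, publicVerification (coins φ (κ * q)) e ψ o = ‖ψ‖ ^ 2 := by
  unfold publicVerification
  rw [sum_norm_sq_foldl (fun i χ => symmetricProjection e i χ)
    fun i χ => norm_sq_starProjection_add _ χ, norm_sq_tensorState, norm_coins hq hφ, one_pow,
    one_mul]

/-- For `n = 0` the left side is `m / (m + 1) ^ κ ≤ (1 / 2) ^ (κ - 1)`. For `n ≥ 1` it is already
nonpositive with the exponent `2`, which is where `2 ≤ κ` enters. -/
lemma mul_pow_div_sub_le {m n κ : ℕ} (hκ : 2 ≤ κ) (hn : n < m) :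
    (m : ℝ) * ((((n + 1) * κ : ℕ) : ℝ) / ((m + 1) * κ : ℕ)) ^ κ - n ≤ (1 / 2) ^ (κ - 1) := by
  have hκ0 : (κ : ℝ) ≠ 0 := by positivity
  have hm1 : (0 : ℝ) < m + 1 := by positivity
  have hnm : (n : ℝ) + 1 ≤ m := by exact_mod_cast hn
  have hq : (((n + 1) * κ : ℕ) : ℝ) / ((m + 1) * κ : ℕ) = ((n : ℝ) + 1) / (m + 1) := by
    push_cast
    rw [mul_div_mul_right _ _ hκ0]
  rw [hq]
  have hr0 : 0 ≤ ((n : ℝ) + 1) / (m + 1) := by positivity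
  have hr1 : ((n : ℝ) + 1) / (m + 1) ≤ 1 := by
    rw [div_le_one hm1]
    linarith
  rcases Nat.eq_zero_or_pos n with rfl | hn0
  · obtain ⟨k, rfl⟩ : ∃ k, κ = k + 1 := ⟨κ - 1, by omega⟩
    have h1 : ((0 : ℕ) : ℝ) = 0 := Nat.cast_zero
    rw [h1] at hr0 hr1 hnm ⊢
    rw [Nat.add_sub_cancel, zero_add, pow_succ', sub_zero, ← mul_assoc]
    have h2 : (m : ℝ) * (1 / (m + 1)) ≤ 1 := by
      rw [mul_one_div, div_le_one hm1]
      linarith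
    have h3 : (1 : ℝ) / (m + 1) ≤ 1 / 2 := by
      apply one_div_le_one_div_of_le <;> linarith
    calc (m : ℝ) * (1 / (m + 1)) * (1 / (m + 1)) ^ k ≤ 1 * (1 / 2) ^ k := by gcongr
      _ = _ := one_mul _
  · have hn1 : (1 : ℝ) ≤ n := by exact_mod_cast hn0
    have h1 : (((n : ℝ) + 1) / (m + 1)) ^ κ ≤ (((n : ℝ) + 1) / (m + 1)) ^ 2 :=
      pow_le_pow_of_le_one hr0 hr1 hκ
    have h2 : (m : ℝ) * (((n : ℝ) + 1) / (m + 1)) ^ 2 ≤ n := by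
      rw [div_pow, mul_div_assoc', div_le_iff₀ (by positivity)]
      -- The difference to be shown nonnegative is `n * (m + 1) ^ 2 - m * (n + 1) ^ 2 = (m - n) * (n
      -- * m - 1)`.
      nlinarith [mul_nonneg (sub_nonneg.2 hnm) (by positivity : (0 : ℝ) ≤ n * m),
        mul_nonneg (by linarith : (0 : ℝ) ≤ m - n)
          (by nlinarith : (0 : ℝ) ≤ (n : ℝ) * m - 1)]
    have h3 : (m : ℝ) * (((n : ℝ) + 1) / (m + 1)) ^ κ ≤ n :=
      (mul_le_mul_of_nonneg_left h1 (Nat.cast_nonneg m)).trans h2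
    have h4 : (0 : ℝ) ≤ (1 / 2) ^ (κ - 1) := by positivity
    linarith

lemma count_le (o : Fin m → Bool) : count o ≤ m := by
  exact (Finset.card_le_univ _).trans_eq (Fintype.card_fin m)

/-- The expected utility from a public count. -/
lemma sum_public_le (hκ : 2 ≤ κ) (hq : 0 < q) {E : Op (Fin q)} (hE : IsStarProjection E)
    {φ : State (Fin q)} (hφ : ‖φ‖ = 1) (hφE : applyOp E φ = φ)
    (e : Fin (m * (κ * q)) ↪ Fin N) (ψ : State (Fin N)) (n : ℕ) :
    ∑ o, publicVerification (coins φ (κ * q)) e ψ o *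
        allOrNothingUtility ⟨count o, 0, n, ∃ i, o i = false⟩ ≤
      (1 / 2) ^ (κ - 1) * ‖ψ‖ ^ 2 +
        m * ∑ O, registersProb (coinRegisters e) E ψ O * if κ * n < hits O then 1 else 0 := by
  classical
  have hnonneg : ∀ o, 0 ≤ publicVerification (coins φ (κ * q)) e ψ o := fun o => sq_nonneg _
  have hD := registersProb_nonneg (coinRegisters e) E ψ
  -- With `m ≤ n` no outcome has positive utility, so the symmetric subspace is needed only for `n <
  -- m`.
  rcases le_or_gt m n with hmn | hmn
  · have h1 : ∀ o : Fin m → Bool,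
        allOrNothingUtility ⟨count o, 0, n, ∃ i, o i = false⟩ ≤ 0 := by
      intro o
      have : (count o : ℝ) ≤ n := by exact_mod_cast (count_le o).trans hmn
      have hn : (0 : ℝ) ≤ n := Nat.cast_nonneg n
      unfold allOrNothingUtility
      split_ifs
      · simp
      · simpa using this
    refine (Finset.sum_nonpos fun o _ => mul_nonpos_of_nonneg_of_nonpos (hnonneg o) (h1 o)).trans ?_
    have : 0 ≤ ∑ O, registersProb (coinRegisters e) E ψ O *
        if κ * n < hits O then (1 : ℝ) else 0 :=
      Finset.sum_nonneg fun O _ => mul_nonneg (hD O) (by split_ifs <;> norm_num)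
    positivity
  -- The minted coins cost `n` in every outcome, while only the outcome without a failure pays `m`.
  · have h1 : ∀ o : Fin m → Bool, publicVerification (coins φ (κ * q)) e ψ o *
        allOrNothingUtility ⟨count o, 0, n, ∃ i, o i = false⟩ =
        (if o = fun _ => true then publicVerification (coins φ (κ * q)) e ψ o * m else 0) -
          publicVerification (coins φ (κ * q)) e ψ o * n := by
      intro o
      unfold allOrNothingUtility
      by_cases ho : o = fun _ => true
      · subst ho
        simp [count, mul_sub]
      · have : ∃ i, o i = false := by
          by_contra h
          push Not at h
          exact ho (funext fun i => by simpa using h i)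
        rw [if_pos this, if_neg ho]
        ring
    simp only [h1]
    rw [Finset.sum_sub_distrib, Finset.sum_ite_eq' Finset.univ, if_pos (Finset.mem_univ _),
      ← Finset.sum_mul, sum_publicVerification hq hφ,
      ← sum_registersProb (coinRegisters_injective e) hE ψ]
    refine (sub_le_sub_right (mul_le_mul_of_nonneg_right
      (publicVerification_true_le hq hE hφ hφE e ψ hmn) (Nat.cast_nonneg m)) _).trans ?_
    rw [Finset.sum_mul, Finset.sum_mul, Finset.mul_sum, Finset.mul_sum, ← Finset.sum_sub_distrib,
      ← Finset.sum_add_distrib]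
    refine Finset.sum_le_sum fun O _ => ?_
    have hpos : (0 : ℝ) ≤ (1 / 2) ^ (κ - 1) := by positivity
    have hn : (0 : ℝ) ≤ n := Nat.cast_nonneg n
    -- For each private result separately: with few hits the gain is at most `m * r - n`, with many
    -- hits at most `m`.
    by_cases hO : hits O ≤ κ * n
    · rw [if_pos hO, if_neg (not_lt.2 hO)]
      nlinarith [mul_le_mul_of_nonneg_right (mul_pow_div_sub_le hκ hmn) (hD O)]
    · rw [if_neg hO, if_pos (not_le.1 hO)]
      nlinarith [mul_nonneg hpos (hD O), mul_nonneg hn (hD O)]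

end publicVerification

open Filter Asymptotics MeasureTheory

/-! ### Running the same program against the private and the public scheme -/

open scoped Classical in
/-- The indicator function of a positive flexible utility. -/
def flexibleWin (r : Outcome) : ℝ := if 0 < flexibleUtility r then 1 else 0

lemma flexibleWin_nonneg (r : Outcome) : 0 ≤ flexibleWin r := by
  unfold flexibleWin
  split_ifs <;> norm_num

lemma flexibleWin_le_one (r : Outcome) : flexibleWin r ≤ 1 := by
  unfold flexibleWin
  split_ifs <;> norm_num

lemma flexibleWin_private (k n : ℕ) :
    flexibleWin ⟨0, k, n, False⟩ = if n < k then 1 else 0 := by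
  simp [flexibleWin, flexibleUtility]

lemma Program.WellFormed.mono {s s' : ℕ} (hs : s ∣ s') {N : ℕ} {P : Program N}
    (hP : P.WellFormed s') : P.WellFormed s := by
  induction P with
  | halt => trivial
  | gate U rest ih => exact ih hP
  | mint c ℓ rest ih => exact ⟨hs.trans hP.1, ih hP.2⟩
  | submit c pub ws rest ih => exact ⟨hs.trans hP.1, ih hP.2⟩

lemma div_eq_mul_div_mul {κ q ℓ : ℕ} (hq : 0 < q) (h : κ * q ∣ ℓ) :
    ℓ / q = κ * (ℓ / (κ * q)) := by
  obtain ⟨t, rfl⟩ := h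
  rcases Nat.eq_zero_or_pos κ with rfl | hκ
  · simp
  · rw [Nat.mul_div_cancel_left _ (mul_pos hκ hq), mul_right_comm, Nat.mul_div_cancel _ hq]

lemma Program.minted_eq {κ q : ℕ} (hq : 0 < q) {N : ℕ} {P : Program N}
    (hP : P.WellFormed (κ * q)) : P.minted q = κ * P.minted (κ * q) := by
  induction P with
  | halt => rfl
  | gate U rest ih => exact ih hP
  | mint c ℓ rest ih => simp only [Program.minted, ih hP.2, div_eq_mul_div_mul hq hP.1, mul_add]
  | submit c pub ws rest ih => exact ih hP.2

lemma Program.submitted_eq {κ q : ℕ} (hq : 0 < q) {N : ℕ} {P : Program N}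
    (hP : P.WellFormed (κ * q)) : P.submitted q = κ * P.submitted (κ * q) := by
  induction P with
  | halt => rfl
  | gate U rest ih => exact ih hP
  | mint c ℓ rest ih => exact ih hP.2
  | submit c pub ws rest ih =>
    simp only [Program.submitted, ih hP.2, div_eq_mul_div_mul hq hP.1, Nat.mul_max_mul_left]

/-! ### Bounds on the game, and the comparison of the two games for a fixed key -/

/-- The probabilities of the verification results are nonnegative and add up to one. -/
def IsVerification {s : ℕ} (V : Verification s) : Prop :=
  ∀ {N m : ℕ} (e : Fin (m * s) ↪ Fin N) (ψ : State (Fin N)),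
    (∀ o, 0 ≤ V e ψ o) ∧ ∑ o, V e ψ o = ‖ψ‖ ^ 2

lemma isVerification_verificationOf {q : ℕ} {E : Op (Fin q)} (hE : IsStarProjection E) :
    IsVerification (verificationOf E) := by
  intro N m e ψ
  simp only [verificationOf_eq hE]
  exact ⟨registersProb_nonneg _ _ _, sum_registersProb (blockRegisters_injective e) hE ψ⟩

lemma isVerification_bankEffect {κ q : ℕ} {E : Op (Fin q)} (hE : IsStarProjection E) :
    IsVerification (verificationOf (bankEffect κ E)) := by
  intro N m e ψ
  simp only [verificationOf_bankEffect hE]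
  refine ⟨fun o => Finset.sum_nonneg fun O _ => mul_nonneg (Finset.prod_nonneg fun i _ => ?_)
    (registersProb_nonneg _ _ _ _), ?_⟩
  · have h1 : (hits fun r => O (i, r)) ≤ κ := by simpa using hits_le_card fun r => O (i, r)
    have h2 : ((hits fun r => O (i, r) : ℕ) : ℝ) / κ ≤ 1 :=
      div_le_one_of_le₀ (by exact_mod_cast h1) (Nat.cast_nonneg κ)
    unfold bankWeight
    split_ifs
    · positivity
    · linarith
  · rw [Finset.sum_comm, ← sum_registersProb (coinRegisters_injective e) hE ψ]
    refine Finset.sum_congr rfl fun O _ => ?_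
    rw [← Finset.sum_mul]
    unfold bankWeight
    rw [sum_prod_bernoulli, one_mul]

lemma isVerification_publicVerification {κ q : ℕ} (hq : 0 < q) {φ : State (Fin q)}
    (hφ : ‖φ‖ = 1) :
    IsVerification (publicVerification (coins φ (κ * q))) :=
  fun e ψ => ⟨fun _ => sq_nonneg _, sum_publicVerification hq hφ e ψ⟩

lemma IsVerification.sum_mul_mem_Icc {s : ℕ} {V : Verification s} (hV : IsVerification V)
    {N m : ℕ} (e : Fin (m * s) ↪ Fin N) (ψ : State (Fin N)) {g : (Fin m → Bool) → ℝ} {a b : ℝ}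
    (hg : ∀ o, g o ∈ Set.Icc a b) :
    ∑ o, V e ψ o * g o ∈ Set.Icc (‖ψ‖ ^ 2 * a) (‖ψ‖ ^ 2 * b) := by
  rw [← (hV e ψ).2, Finset.sum_mul, Finset.sum_mul]
  exact ⟨Finset.sum_le_sum fun o _ => mul_le_mul_of_nonneg_left (hg o).1 ((hV e ψ).1 o),
    Finset.sum_le_sum fun o _ => mul_le_mul_of_nonneg_left (hg o).2 ((hV e ψ).1 o)⟩

/-- The weights of the branches of a run add up to `‖ψ‖ ^ 2`, so the expectation inherits the bounds
on `f`. This supplies the boundedness behind integrability over the key. -/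
lemma runFrom_mem_Icc {s : ℕ} (hs : 0 < s) {φ : State (Fin s)} (hφ : ‖φ‖ = 1)
    {sk : Verification s} (hsk : IsVerification sk) {pk : Option (Verification s)}
    (hpk : ∀ V : Verification s, pk = some @V → IsVerification V) {f : Outcome → ℝ} {S T : ℕ}
    {a b : ℝ} (hf : ∀ r : Outcome, r.m ≤ S → r.m' ≤ S → r.n ≤ T → f r ∈ Set.Icc a b) {N : ℕ}
    (P : Program N) (hP : P.WellFormed s) (hS : P.submitted s ≤ S) (ψ : State (Fin N)) (n : ℕ)
    (hT : n + P.minted s ≤ T) :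
    runFrom φ sk pk f P ψ n ∈ Set.Icc (‖ψ‖ ^ 2 * a) (‖ψ‖ ^ 2 * b) := by
  induction P generalizing n with
  | halt =>
    have := hf ⟨0, 0, n, False⟩ (Nat.zero_le _) (Nat.zero_le _) hT
    exact ⟨mul_le_mul_of_nonneg_left this.1 (sq_nonneg _),
      mul_le_mul_of_nonneg_left this.2 (sq_nonneg _)⟩
  | gate U rest ih =>
    rw [← norm_applyOp_unitary U ψ]
    exact ih hP hS _ _ hT
  | mint c ℓ rest ih =>
    obtain ⟨⟨t, ht⟩, hP⟩ := hP
    have hT1 : n + ℓ / s + rest.minted s ≤ T := (Nat.add_assoc _ _ _).trans_le hT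
    have hT2 : n + rest.minted s ≤ T := (Nat.add_le_add_left (Nat.le_add_left _ _) n).trans hT
    have h1 := ih hP hS (append (measured c true ψ) (coins φ ℓ)) (n + ℓ / s) hT1
    have h2 := ih hP hS (append (measured c false ψ) (zeros ℓ)) n hT2
    have h3 : ‖coins φ ℓ‖ = 1 := by
      rw [ht, mul_comm]
      exact norm_coins hs hφ
    rw [norm_sq_append, h3, one_pow, mul_one] at h1
    rw [norm_sq_append, norm_zeros, one_pow, mul_one] at h2
    rw [← norm_sq_measured_add c ψ, add_mul, add_mul]
    exact ⟨add_le_add h1.1 h2.1, add_le_add h1.2 h2.2⟩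
  | @submit N c pub ℓ ws rest ih =>
    have hS' : ℓ / s ≤ S ∧ rest.submitted s ≤ S := max_le_iff.1 hS
    have h2 := ih hP.2 hS'.2 (measured c false ψ) n hT
    have hn : n ≤ T := (Nat.le_add_right _ _).trans hT
    have hprivate := hsk.sum_mul_mem_Icc ((blocksEmb ℓ s).trans ws) (measured c true ψ)
      fun o => hf ⟨0, count o, n, False⟩ (Nat.zero_le _) ((count_le o).trans hS'.1) hn
    rw [← norm_sq_measured_add c ψ, add_mul, add_mul]
    cases pk with
    | none => exact ⟨add_le_add hprivate.1 h2.1, add_le_add hprivate.2 h2.2⟩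
    | some V =>
      cases pub with
      | false => exact ⟨add_le_add hprivate.1 h2.1, add_le_add hprivate.2 h2.2⟩
      | true =>
        have hpublic := IsVerification.sum_mul_mem_Icc (hpk V rfl) ((blocksEmb ℓ s).trans ws)
          (measured c true ψ) fun o => hf ⟨count o, 0, n, ∃ i, o i = false⟩
            ((count_le o).trans hS'.1) (Nat.zero_le _) hn
        exact ⟨add_le_add hpublic.1 h2.1, add_le_add hpublic.2 h2.2⟩

lemma allOrNothingUtility_mem_Icc {S T : ℕ} (r : Outcome) (hm : r.m ≤ S) (hm' : r.m' ≤ S)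
    (hn : r.n ≤ T) :
    allOrNothingUtility r ∈ Set.Icc (-(T : ℝ)) (2 * S) := by
  have h1 : (r.m : ℝ) ≤ S := by exact_mod_cast hm
  have h2 : (r.m' : ℝ) ≤ S := by exact_mod_cast hm'
  have h3 : (r.n : ℝ) ≤ T := by exact_mod_cast hn
  have h4 : (0 : ℝ) ≤ r.m := Nat.cast_nonneg _
  have h5 : (0 : ℝ) ≤ r.m' := Nat.cast_nonneg _
  have h6 : (0 : ℝ) ≤ r.n := Nat.cast_nonneg _
  unfold allOrNothingUtility
  split_ifs <;> constructor <;> linarith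

/-- The expected all-or-nothing utility against the public scheme is bounded by the winning
probability of the same program against the private scheme. -/
lemma runFrom_public_le {κ q M : ℕ} (hκ : 2 ≤ κ) (hq : 0 < q) {E : Op (Fin q)}
    (hE : IsStarProjection E) {φ : State (Fin q)} (hφ : ‖φ‖ = 1) (hφE : applyOp E φ = φ) {N : ℕ}
    (P : Program N) (hP : P.WellFormed (κ * q)) (hM : P.submitted (κ * q) ≤ M)
    (ψ : State (Fin N)) (n : ℕ) :
    runFrom (coins φ (κ * q)) (verificationOf (bankEffect κ E))
        (some (publicVerification (coins φ (κ * q)))) allOrNothingUtility P ψ n ≤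
      (1 / 2) ^ (κ - 1) * ‖ψ‖ ^ 2 +
        M * runFrom φ (verificationOf E) none flexibleWin P ψ (κ * n) := by
  have hκ0 : 0 < κ := by omega
  induction P generalizing n with
  | halt =>
    have h1 : allOrNothingUtility ⟨0, 0, n, False⟩ ≤ 0 := by simp [allOrNothingUtility]
    have h2 := flexibleWin_nonneg ⟨0, 0, κ * n, False⟩
    refine (mul_nonpos_of_nonneg_of_nonpos (sq_nonneg _) h1).trans ?_
    simp only [runFrom]
    positivity
  | gate U rest ih =>
    rw [← norm_applyOp_unitary U ψ]
    exact ih hP hM _ _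
  | mint c ℓ rest ih =>
    -- The invariant "`n` public coins, `κ * n` private coins" survives a mint call, since `κ * (n +
    -- ℓ / (κ * q)) = κ * n + ℓ / q`.
    have h1 := ih hP.2 hM (append (measured c true ψ) (coins φ ℓ)) (n + ℓ / (κ * q))
    have h2 := ih hP.2 hM (append (measured c false ψ) (zeros ℓ)) n
    have h3 : ‖coins φ ℓ‖ = 1 := by
      obtain ⟨t, rfl⟩ := (Dvd.intro_left κ rfl).trans hP.1
      rw [mul_comm]
      exact norm_coins hq hφ
    rw [norm_sq_append, h3, one_pow, mul_one, mul_add, ← div_eq_mul_div_mul hq hP.1] at h1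
    rw [norm_sq_append, norm_zeros, one_pow, mul_one] at h2
    rw [← norm_sq_measured_add c ψ]
    simp only [runFrom]
    rw [coins_coins hq hκ0 hP.1]
    linarith
  | @submit N c pub ℓ ws rest ih =>
    have hM' : ℓ / (κ * q) ≤ M ∧ rest.submitted (κ * q) ≤ M := max_le_iff.1 hM
    have h2 := ih hP.2 hM'.2 (measured c false ψ) n
    set e := (blocksEmb ℓ (κ * q)).trans ws with he
    set W := ∑ O, registersProb (coinRegisters e) E (measured c true ψ) O *
      if κ * n < hits O then (1 : ℝ) else 0 with hW
    have hW0 : 0 ≤ W := Finset.sum_nonneg fun O _ =>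
      mul_nonneg (registersProb_nonneg _ _ _ _) (by split_ifs <;> norm_num)
    have hWM : ((ℓ / (κ * q) : ℕ) : ℝ) * W ≤ M * W :=
      mul_le_mul_of_nonneg_right (by exact_mod_cast hM'.1) hW0
    have hpos : (0 : ℝ) ≤ (1 / 2) ^ (κ - 1) * ‖measured c true ψ‖ ^ 2 := by positivity
    -- The private scheme answers either kind of query by its private count, so the same win
    -- probability `W` serves both cases of `pub`.
    have hpr : ∑ o, verificationOf E ((blocksEmb ℓ q).trans ws) (measured c true ψ) o *
        flexibleWin ⟨0, count o, κ * n, False⟩ = W := by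
      simp only [flexibleWin_private]
      exact sum_verificationOf hκ0 hq hP.1 hE ws (measured c true ψ)
        fun k => if κ * n < k then 1 else 0
    rw [← norm_sq_measured_add c ψ]
    cases pub with
    | false =>
      have h1 := sum_bank_le hκ0 hE e (measured c true ψ) n
      simp only [runFrom]
      rw [hpr]
      linarith
    | true =>
      have h1 := sum_public_le hκ hq hE hφ hφE e (measured c true ψ) n
      simp only [runFrom]
      rw [hpr]
      linarith

/-! ### Measurability -/

section measurability

variable {Ω : Type*} [MeasurableSpace Ω]

/-- The probabilities of the verification results depend measurably on a parameter. -/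
def MeasurableVerification {s : ℕ} (V : Ω → Verification s) : Prop :=
  ∀ {N m : ℕ} (e : Fin (m * s) ↪ Fin N) {ψ : Ω → State (Fin N)},
    (∀ x, Measurable fun ω => ψ ω x) → ∀ o, Measurable fun ω => V ω e (ψ ω) o

lemma measurable_resultsEffect {q m : ℕ} {E : Ω → Op (Fin q)}
    (hE : ∀ x y, Measurable fun ω => E ω x y) (o : Fin m → Bool) (x y : Fin (m * q) → Bool) :
    Measurable fun ω => resultsEffect (E ω) o x y := by
  unfold resultsEffect tensorOp
  refine Finset.measurable_prod _ fun i _ => ?_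
  dsimp only
  split_ifs
  · exact hE _ _
  · exact measurable_const.sub (hE _ _)

lemma measurable_bankEffect {κ q : ℕ} {E : Ω → Op (Fin q)}
    (hE : ∀ x y, Measurable fun ω => E ω x y) (x y : Fin (κ * q) → Bool) :
    Measurable fun ω => bankEffect κ (E ω) x y := by
  simp only [bankEffect, Matrix.sum_apply, Matrix.smul_apply, smul_eq_mul]
  exact Finset.measurable_sum _ fun o _ => (measurable_resultsEffect hE o x y).const_mul _

lemma measurableVerification_verificationOf {q : ℕ} {E : Ω → Op (Fin q)}
    (hE : ∀ x y, Measurable fun ω => E ω x y) :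
    MeasurableVerification fun ω => verificationOf (E ω) := by
  intro N m e ψ hψ o
  unfold verificationOf
  refine Complex.measurable_re.comp ?_
  simp only [PiLp.inner_apply, RCLike.inner_apply, applyOp_apply]
  refine Finset.measurable_sum _ fun x _ => Measurable.mul (Finset.measurable_sum _ fun y _ =>
    Measurable.mul ?_ (hψ y)) (Complex.continuous_conj.measurable.comp (hψ x))
  unfold onWires
  split_ifs
  · exact measurable_resultsEffect hE _ _ _
  · exact measurable_const

lemma measurable_coins {q : ℕ} {φ : Ω → State (Fin q)} (hφ : ∀ x, Measurable fun ω => φ ω x)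
    (ℓ : ℕ) (x : Fin ℓ → Bool) : Measurable fun ω => coins (φ ω) ℓ x := by
  simp only [coins]
  split_ifs
  · exact Finset.measurable_prod _ fun i _ => hφ _
  · exact measurable_const

/-- The key enters only through the wallet coin and the state: the symmetric projections themselves
are fixed continuous maps. -/
lemma measurableVerification_publicVerification {κ q : ℕ} {cent : Ω → State (Fin (κ * q))}
    (hc : ∀ x, Measurable fun ω => cent ω x) :
    MeasurableVerification fun ω => publicVerification (cent ω) := by
  intro N m e ψ hψ o
  have hfold : ∀ (l : List (Fin m)) (χ : Ω → State (Fin (κ * q) ⊕ Fin N)), Measurable χ →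
      Measurable fun ω => l.foldl (fun χ i => if o i = true then symmetricProjection e i χ
        else χ - symmetricProjection e i χ) (χ ω) := by
    intro l
    induction l with
    | nil => exact fun χ hχ => hχ
    | cons i l ih =>
      intro χ hχ
      have hp : Measurable fun ω => symmetricProjection e i (χ ω) :=
        (symmetricProjection e i).continuous.measurable.comp hχ
      refine ih (fun ω => if o i = true then symmetricProjection e i (χ ω)
        else χ ω - symmetricProjection e i (χ ω)) ?_
      split_ifs
      · exact hp
      · exact hχ.sub hp
  refine (hfold (List.finRange m) (fun ω => tensorState (cent ω) (ψ ω)) ?_).norm.pow_const 2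
  refine (WithLp.measurable_toLp 2 _).comp (measurable_pi_iff.2 fun x => ?_)
  exact (hc _).mul (hψ _)

lemma measurable_runFrom {s : ℕ} {φ : Ω → State (Fin s)} (hφ : ∀ x, Measurable fun ω => φ ω x)
    {sk : Ω → Verification s} (hsk : MeasurableVerification sk)
    {pk : Option (Ω → Verification s)}
    (hpk : ∀ V : Ω → Verification s, pk = some V → MeasurableVerification V) (f : Outcome → ℝ)
    {N : ℕ} (P : Program N) {ψ : Ω → State (Fin N)} (hψ : ∀ x, Measurable fun ω => ψ ω x)
    (n : ℕ) :
    Measurable fun ω => runFrom (φ ω) (sk ω) (pk.map fun V => V ω) f P (ψ ω) n := by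
  have hmeas : ∀ {N : ℕ} {ψ : Ω → State (Fin N)} (c : Fin N) (b : Bool),
      (∀ x, Measurable fun ω => ψ ω x) → ∀ x, Measurable fun ω => measured c b (ψ ω) x := by
    intro N ψ c b hψ x
    simp only [measured]
    split_ifs
    exacts [hψ x, measurable_const]
  induction P generalizing n with
  | halt =>
    simp only [runFrom, EuclideanSpace.norm_sq_eq]
    exact (Finset.measurable_sum _ fun x _ => ((hψ x).norm.pow_const 2)).mul_const _
  | gate U rest ih =>
    refine ih (fun x => ?_) n
    simp only [applyOp_apply]
    exact Finset.measurable_sum _ fun y _ => (hψ y).const_mul _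
  | mint c ℓ rest ih =>
    refine (ih (fun x => ?_) _).add (ih (fun x => ?_) _)
    · exact (hmeas c true hψ _).mul (measurable_coins hφ ℓ _)
    · exact (hmeas c false hψ _).mul measurable_const
  | submit c pub ws rest ih =>
    refine Measurable.add ?_ (ih (hmeas c false hψ) n)
    have hprivate := fun o => hsk ((blocksEmb _ s).trans ws) (hmeas c true hψ) o
    cases pk with
    | none => exact Finset.measurable_sum _ fun o _ => (hprivate o).mul_const _
    | some V =>
      cases pub with
      | false => exact Finset.measurable_sum _ fun o _ => (hprivate o).mul_const _
      | true =>
        exact Finset.measurable_sum _ fun o _ =>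
          (hpk V rfl ((blocksEmb _ s).trans ws) (hmeas c true hψ) o).mul_const _

end measurability

/-! ### Averaging the comparison over the secret key -/

lemma gameProbability_flexible (Pr : PrivateCoinScheme.{u}) (A : Adversary) (sec : ℕ) :
    gameProbability Pr.toCoinScheme A sec (fun r => 0 < flexibleUtility r) =
      ∫ sk, runFrom (Pr.coin sec sk) (verificationOf (Pr.verify sec sk)) none flexibleWin
        (A.program sec) (zeros (A.width sec)) 0 ∂(Pr.keyGen sec) := rfl

lemma gameExpectation_public_le (Pr : PrivateCoinScheme.{u}) (hproj : Pr.IsRankOneProjective)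
    (κ : ℕ → ℕ) (A : Adversary) {sec M : ℕ} (hκ : 2 ≤ κ sec)
    (hP : (A.program sec).WellFormed (κ sec * Pr.qubits sec))
    (hM : (A.program sec).submitted (κ sec * Pr.qubits sec) ≤ M) :
    gameExpectation (Pr.publicScheme κ) A sec allOrNothingUtility ≤
      (1 / 2) ^ (κ sec - 1) +
        M * gameProbability Pr.toCoinScheme A sec fun r => 0 < flexibleUtility r := by
  have hq := Pr.qubits_pos sec
  have hκq : 0 < κ sec * Pr.qubits sec := mul_pos (by omega) hq
  set f : Pr.Key sec → ℝ := fun sk => runFrom (coins (Pr.coin sec sk) (κ sec * Pr.qubits sec))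
    (verificationOf (bankEffect (κ sec) (Pr.verify sec sk)))
    (some (publicVerification (coins (Pr.coin sec sk) (κ sec * Pr.qubits sec))))
    allOrNothingUtility (A.program sec) (zeros (A.width sec)) 0 with hf
  set g : Pr.Key sec → ℝ := fun sk => runFrom (Pr.coin sec sk)
    (verificationOf (Pr.verify sec sk)) none flexibleWin (A.program sec) (zeros (A.width sec)) 0
    with hg
  have hfi : Integrable f (Pr.keyGen sec) := by
    have hcoin := measurable_coins (Pr.measurable_coin sec) (κ sec * Pr.qubits sec)
    have hfm : Measurable f := measurable_runFrom hcoin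
      (measurableVerification_verificationOf (measurable_bankEffect (Pr.measurable_verify sec)))
      (pk := some fun sk => publicVerification (coins (Pr.coin sec sk) (κ sec * Pr.qubits sec)))
      (fun V hV => by
        cases hV
        exact measurableVerification_publicVerification hcoin)
      allOrNothingUtility (A.program sec) (fun _ => measurable_const) 0
    refine Integrable.of_mem_Icc _ _ hfm.aemeasurable (ae_of_all _ fun sk =>
      runFrom_mem_Icc hκq (norm_coins hq (Pr.norm_coin sec sk))
        (isVerification_bankEffect (hproj sec sk).1) (fun V hV => ?_)
        allOrNothingUtility_mem_Icc (A.program sec) hP hM (zeros (A.width sec)) 0 le_rfl)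
    cases hV
    exact isVerification_publicVerification hq (Pr.norm_coin sec sk)
  have hgi : Integrable g (Pr.keyGen sec) := by
    have hgm : Measurable g := measurable_runFrom (Pr.measurable_coin sec)
      (measurableVerification_verificationOf (Pr.measurable_verify sec)) (pk := none)
      (fun V hV => by cases hV) flexibleWin (A.program sec) (fun _ => measurable_const) 0
    refine Integrable.of_mem_Icc _ _ hgm.aemeasurable (ae_of_all _ fun sk =>
      runFrom_mem_Icc hq (Pr.norm_coin sec sk) (isVerification_verificationOf (hproj sec sk).1)
        (fun V hV => by cases hV) (fun r _ _ _ => ⟨flexibleWin_nonneg r, flexibleWin_le_one r⟩)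
        (A.program sec) (hP.mono (Dvd.intro_left _ rfl)) le_rfl (zeros (A.width sec)) 0 le_rfl)
  have hint : ∫ sk, ((1 / 2 : ℝ) ^ (κ sec - 1) + M * g sk) ∂(Pr.keyGen sec) =
      (1 / 2) ^ (κ sec - 1) + M * ∫ sk, g sk ∂(Pr.keyGen sec) := by
    rw [integral_add (integrable_const _) (hgi.const_mul _), integral_const_mul]
    simp
  rw [gameProbability_flexible, ← hint]
  refine integral_mono_ae (μ := Pr.keyGen sec) hfi
    ((integrable_const _).add (hgi.const_mul _)) ?_
  -- Perfect completeness holds for almost every key, hence so does the pointwise comparison; this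
  -- suffices for the integrals.
  filter_upwards [Pr.complete sec] with sk hsk
  have h := runFrom_public_le hκ hq (hproj sec sk).1 (Pr.norm_coin sec sk)
    (applyOp_eq_self_of_inner_eq_one (hproj sec sk).1 (Pr.norm_coin sec sk) hsk)
    (A.program sec) hP hM (zeros (A.width sec)) 0
  rw [norm_zeros, one_pow, mul_one, mul_zero] at h
  exact h

/-! ### Asymptotics -/

lemma tendsto_logb_natCast_atTop :
    Tendsto (fun sec : ℕ => Real.logb 2 sec) atTop atTop :=
  (Real.tendsto_logb_atTop one_lt_two).comp tendsto_natCast_atTop_atTop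

/-- With `L = log₂ λ`, multiplying by `λ ^ n = 2 ^ (n * L)` gives the exponent `n * L - L ^ c`,
which tends to `-∞` because `c > 1`. -/
lemma negligible_two_rpow_neg {c : ℝ} (hc : 1 < c) :
    Negligible fun sec => (2 : ℝ) ^ (-(Real.logb 2 sec ^ c)) := by
  intro n
  have h1 : Tendsto (fun L : ℝ => n * L - L ^ c) atTop atBot := by
    have h2 : Tendsto (fun L : ℝ => L * (L ^ (c - 1) - n)) atTop atTop :=
      tendsto_id.atTop_mul_atTop₀
        (tendsto_atTop_add_const_right _ (-(n : ℝ)) (tendsto_rpow_atTop (by linarith)))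
    refine (tendsto_neg_atTop_atBot.comp h2).congr' ?_
    filter_upwards [eventually_gt_atTop 0] with L hL
    have : L * L ^ (c - 1) = L ^ c := by
      rw [Real.rpow_sub_one hL.ne', mul_div_cancel₀ _ hL.ne']
    simp only [Function.comp_apply, mul_sub, this]
    ring
  have h3 := ((tendsto_rpow_atBot_of_base_gt_one 2 one_lt_two).comp h1).comp
    tendsto_logb_natCast_atTop
  refine h3.congr' ?_
  filter_upwards [eventually_gt_atTop 0] with sec hsec
  have hsec' : (0 : ℝ) < sec := by exact_mod_cast hsec
  simp only [Function.comp_apply]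
  rw [sub_eq_add_neg, Real.rpow_add two_pos, mul_comm (n : ℝ), Real.rpow_mul two_pos.le,
    Real.rpow_logb two_pos (by norm_num) hsec', Real.rpow_natCast]

lemma eventually_two_le_kappa {c : ℝ} (hc : 1 < c) : ∀ᶠ sec in atTop, 2 ≤ kappa c sec := by
  have h := (tendsto_rpow_atTop (zero_lt_one.trans hc)).comp tendsto_logb_natCast_atTop
  filter_upwards [h.eventually_ge_atTop 2] with sec hsec
  have : ((2 : ℕ) : ℝ) ≤ kappa c sec := by
    push_cast
    exact hsec.trans (Nat.le_ceil _)
  exact_mod_cast this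

lemma negligible_half_pow_kappa {c : ℝ} (hc : 1 < c) :
    Negligible fun sec => (1 / 2 : ℝ) ^ (kappa c sec - 1) := by
  refine ((negligible_two_rpow_neg hc).const_mul 2).trans_eventually_abs_le ?_
  filter_upwards [eventually_two_le_kappa hc] with sec hsec
  have h1 : (1 / 2 : ℝ) ^ (kappa c sec - 1) = 2 * (2 : ℝ) ^ (-(kappa c sec : ℝ)) := by
    rw [Real.rpow_neg two_pos.le, Real.rpow_natCast, one_div, inv_pow]
    obtain ⟨k, hk⟩ : ∃ k, kappa c sec = k + 1 := ⟨kappa c sec - 1, by omega⟩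
    rw [hk, Nat.add_sub_cancel, pow_succ]
    field_simp
  have h2 : Real.logb 2 sec ^ c ≤ kappa c sec := Nat.le_ceil _
  simp only [Function.comp_apply]
  rw [abs_of_nonneg (by positivity), abs_of_nonneg (by positivity), h1]
  gcongr
  exact one_le_two

/-- From `log₂ λ ≤ λ`. The polynomial bound keeps adversaries polynomial when their coins are
counted as private coins. -/
lemma kappa_le_pow {c : ℝ} (hc : 1 < c) (sec : ℕ) : kappa c sec ≤ sec ^ ⌈c⌉₊ := by
  have hc0 : 0 < c := zero_lt_one.trans hc
  rcases Nat.eq_zero_or_pos sec with rfl | hsec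
  · simp [kappa, Real.zero_rpow hc0.ne']
  · have h1 : (1 : ℝ) ≤ sec := by exact_mod_cast hsec
    have h2 : Real.logb 2 sec ≤ sec := by
      rw [Real.logb_le_iff_le_rpow one_lt_two (by linarith), Real.rpow_natCast]
      exact_mod_cast Nat.lt_two_pow_self.le
    refine Nat.ceil_le.2 ?_
    push_cast
    rw [← Real.rpow_natCast]
    exact (Real.rpow_le_rpow (Real.logb_nonneg one_lt_two h1) h2 hc0.le).trans
      (Real.rpow_le_rpow_of_exponent_le h1 (Nat.le_ceil c))

lemma exists_negligible_gameExpectation_le (Pr : PrivateCoinScheme.{u})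
    (hproj : Pr.IsRankOneProjective) {c : ℝ} (hc : 1 < c) (A : Adversary)
    (hA : ∀ sec, (A.program sec).WellFormed (kappa c sec * Pr.qubits sec)) (p : Polynomial ℕ)
    (hp : ∀ sec, (A.program sec).submitted (kappa c sec * Pr.qubits sec) ≤ p.eval sec)
    (h : ∃ ε, Negligible ε ∧ ∀ sec,
      gameProbability Pr.toCoinScheme A sec (fun r => 0 < flexibleUtility r) ≤ ε sec) :
    ∃ ε, Negligible ε ∧ ∀ sec,
      gameExpectation (Pr.publicScheme (kappa c)) A sec allOrNothingUtility ≤ ε sec := by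
  obtain ⟨ε, hε, hle⟩ := h
  have hneg := (negligible_half_pow_kappa hc).add
    (hε.polynomial_mul (p.map (Nat.castRingHom ℝ)))
  -- The comparison needs `2 ≤ κ`, which holds only eventually. At the finitely many other
  -- parameters the expectation serves as its own bound, without affecting negligibility.
  refine ⟨fun sec => if 2 ≤ kappa c sec then
    (1 / 2) ^ (kappa c sec - 1) + (p.eval sec : ℕ) * ε sec
    else gameExpectation (Pr.publicScheme (kappa c)) A sec allOrNothingUtility,
    hneg.congr' ?_, fun sec => ?_⟩
  · filter_upwards [eventually_two_le_kappa hc] with sec hsec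
    rw [if_pos hsec]
    simp [Polynomial.eval_natCast_map]
  · dsimp only
    split_ifs with hsec
    · refine (gameExpectation_public_le Pr hproj (kappa c) A hsec (hA sec) (hp sec)).trans ?_
      have := hle sec
      gcongr
    · exact le_rfl

/-! ### Transferring adversaries -/

lemma length_unary (n : ℕ) : (unary n).length = n + 1 := by simp [unary]

/-- The length of a query is written in unary in the description, so a polynomially long description
can submit only polynomially many coins. -/
lemma Circuit.submitted_toProgram_le (s : ℕ) {N : ℕ} (C : Circuit N) :
    C.toProgram.submitted s ≤ C.encode.length := by
  induction C with
  | halt => exact Nat.zero_le _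
  | hadamard i rest ih =>
    simp only [Circuit.toProgram, Program.submitted, Circuit.encode, List.length_append]
    omega
  | tGate i rest ih =>
    simp only [Circuit.toProgram, Program.submitted, Circuit.encode, List.length_append]
    omega
  | cnot i j h rest ih =>
    simp only [Circuit.toProgram, Program.submitted, Circuit.encode, List.length_append]
    omega
  | mint c ℓ rest ih =>
    simp only [Circuit.toProgram, Program.submitted, Circuit.encode, List.length_append]
    omega
  | @submit N c pub ℓ ws rest ih =>
    have := Nat.div_le_self ℓ s
    simp only [Circuit.toProgram, Program.submitted, Circuit.encode, List.length_append,
      length_unary]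
    omega

/-- The circuits and the machine producing them are unchanged; the coin size enters only through
divisibility, which passes from `κ * q` to `q`. -/
lemma IsQPT.of_mul {κ q : ℕ → ℕ} {A : Adversary} (hA : IsQPT (fun sec => κ sec * q sec) A) :
    IsQPT q A :=
  ⟨fun sec => (hA.1 sec).mono (Dvd.intro_left _ rfl), hA.2⟩

lemma IsQPT.exists_submitted_le {s : ℕ → ℕ} {A : Adversary} (hA : IsQPT s A) :
    ∃ p : Polynomial ℕ, ∀ sec, (A.program sec).submitted (s sec) ≤ p.eval sec := by
  obtain ⟨_, C, hC, ⟨p, hp⟩, _⟩ := hA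
  refine ⟨p, fun sec => ?_⟩
  rw [hC]
  refine ((C sec).submitted_toProgram_le _).trans (le_trans ?_ (hp sec))
  simp [describe]

/-- Every public coin counts as `κ` private ones, so the polynomial bound is multiplied by one for
`κ`. -/
lemma IsUnbounded.of_mul {κ q : ℕ → ℕ} (hq : ∀ sec, 0 < q sec) {r : Polynomial ℕ}
    (hr : ∀ sec, κ sec ≤ r.eval sec) {A : Adversary}
    (hA : IsUnbounded (fun sec => κ sec * q sec) A) : IsUnbounded q A := by
  obtain ⟨hW, p, hp⟩ := hA
  refine ⟨fun sec => (hW sec).mono (Dvd.intro_left _ rfl), r * p, fun sec => ?_⟩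
  rw [Program.minted_eq (hq sec) (hW sec), Program.submitted_eq (hq sec) (hW sec),
    Polynomial.eval_mul]
  exact ⟨Nat.mul_le_mul (hr sec) (hp sec).1, Nat.mul_le_mul (hr sec) (hp sec).2⟩

end QuantumCoin

end

theorem mainTheorem2 (Pr : QuantumCoin.PrivateCoinScheme.{u}) (hproj : Pr.IsRankOneProjective)
    (c : ℝ) (hc : 1 < c) :
    (QuantumCoin.FlexibleNonadaptiveUnforgeable Pr.toCoinScheme QuantumCoin.IsQPT →
      QuantumCoin.AllOrNothingNonadaptiveRationallyUnforgeable
        (Pr.publicScheme (QuantumCoin.kappa c)) QuantumCoin.IsQPT) ∧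
    (QuantumCoin.FlexibleNonadaptiveUnforgeable Pr.toCoinScheme QuantumCoin.IsUnbounded →
      QuantumCoin.AllOrNothingNonadaptiveRationallyUnforgeable
        (Pr.publicScheme (QuantumCoin.kappa c)) QuantumCoin.IsUnbounded) := by
  constructor
  · intro h A hA
    obtain ⟨p, hp⟩ := hA.exists_submitted_le
    exact QuantumCoin.exists_negligible_gameExpectation_le Pr hproj hc A hA.1 p hp
      (h A (QuantumCoin.IsQPT.of_mul hA))
  · intro h A hA
    obtain ⟨p, hp⟩ := hA.2
    refine QuantumCoin.exists_negligible_gameExpectation_le Pr hproj hc A hA.1 p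
      (fun sec => (hp sec).2) (h A ?_)
    exact QuantumCoin.IsUnbounded.of_mul Pr.qubits_pos
      (r := Polynomial.X ^ ⌈c⌉₊) (fun sec => by simpa using QuantumCoin.kappa_le_pow hc sec) hA
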